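/- Let $\lambda\ge 0$ and let $$\nu_\lambda(dx)=\frac{2^{2\lambda}\Gamma(\lambda+1)^2}{\pi\,\Gamma(2\lambda+1)}\,\mathbf 1_{[-1,1]}(x)\,(1-x^2)^{\lambda-1/2}\,dx$$ be the Gegenbauer law on $[-1,1]$. For $0\le u<1$ put $$f_\lambda(u)=\int_1^{1/u}\frac{[(t-1)(1-ut)]^{\lambda-1}}{t^{\lambda+1}}\,dt\qquad(\lambda>0,\ 1/0=\infty),$$ and for $x,y\in(-1,1)$, with $s=\sqrt{(1-x^2)(1-y^2)}$, put $H_0(x,y)=1-xy$ and $$H_\lambda(x,y)=\frac{\Gamma(2\lambda)\,(1-xy+s)^{\lambda}}{2^{3\lambda-1}\,\Gamma(\lambda)^2\,\big((1-x^2)(1-y^2)\big)^{\lambda-1/2}}\;f_\lambda\!\left(\frac{(x-y)^2}{(1-xy+s)^2}\right)\qquad(\lambda>0).$$ Let $\phi_n$ ($n\ge 0$) be the Gegenbauer polynomials $C_n^\lambda$ normalized in $L^2(\nu_\lambda)$, where $\sum_n r^nC_n^\lambda(x)=(1-2rx+r^2)^{-\lambda}$ for $\lambda>0$, and $C_0^0=1$,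 $C_n^0=T_n/n$ ($n\ge1$), with $T_n$ the Chebyshev polynomials of the first kind. Let $L_\lambda f(x)=-(1-x^2)f''(x)+(2\lambda+1)xf'(x)$, let $N_\lambda$ be the number operator $N_\lambda\phi_n=n\phi_n$, with quadratic form $\langle N_\lambda\phi,\phi\rangle=\sum_n n\big(\int\phi\,\phi_n\,d\nu_\lambda\big)^2$, and let $P_\lambda\phi=\int\phi\,d\nu_\lambda$. **Theorem.** The kernel $H_\lambda$ extends from $(-1,1)^2$ to a continuous function on $[-1,1]^2$ if $\lambda\le 1$, and on $[-1,1]^2\setminus\{(1,1),(-1,-1)\}$ if $\lambda>1$. For every $\phi\in C^1([-1,1])$ the integrals below converge absolutely, and $$\text{(1)}\quad \int\phi'(x)^2(1-x^2)\,\nu_\lambda(dx)\ \ge\ \frac{2\lambda+1}{2}\iint\Big(\frac{\phi(x)-\phi(y)}{x-y}\Big)^2H_\lambda(x,y)\,\nu_\lambda(dx)\nu_\lambda(dy),$$ $$\text{(2)}\quad \iint\Big(\frac{\phi(x)-\phi(y)}{x-y}\Big)^2H_\lambda(x,y)\,\nu_\lambda(dx)\nu_\lambda(dy)\ \ge\ 2\,\mathrm{Var}_{\nu_\lambda}(\phi).$$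 These express $L_\lambda\ge(2\lambda+1)N_\lambda$ and $N_\lambda\ge 1-P_\lambda$ in the sense of quadratic forms: for $\phi\in C^1([-1,1])$, $$\langle N_\lambda\phi,\phi\rangle=\frac12\iint\Big(\frac{\phi(x)-\phi(y)}{x-y}\Big)^2H_\lambda(x,y)\,\nu_\lambda(dx)\nu_\lambda(dy),\qquad \int\phi\,(\phi-P_\lambda\phi)\,d\nu_\lambda=\mathrm{Var}_{\nu_\lambda}(\phi),$$ and, if moreover $\phi\in C^2([-1,1])$, $\int\phi\,L_\lambda\phi\,d\nu_\lambda=\int\phi'(x)^2(1-x^2)\,\nu_\lambda(dx)$, the integral on the left converging absolutely. -/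

import Mathlib

open MeasureTheory ProbabilityTheory Set

noncomputable section

namespace Gegenbauer

/-- The Gegenbauer law `ν_lam` on `[-1, 1]`, with density
`2^(2 lam) Γ(lam + 1)^2 / (π Γ(2 lam + 1)) * (1 - x^2)^(lam - 1/2)`. -/
def law (lam : ℝ) : Measure ℝ :=
  (volume.restrict (Icc (-1 : ℝ) 1)).withDensity fun x =>
    ENNReal.ofReal
      ((2 : ℝ) ^ (2 * lam) * Real.Gamma (lam + 1) ^ 2 / (Real.pi * Real.Gamma (2 * lam + 1))
        * (1 - x ^ 2) ^ (lam - 1 / 2))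

/-- The function `f_lam(u) = ∫_1^{1/u} ((t - 1)(1 - u t))^(lam - 1) / t^(lam + 1) dt`.
The domain of integration `(1, 1/u)` is written as `{t | 1 < t, u t < 1}`, so that `u = 0`
gives the integral over `(1, ∞)`. -/
def kernelAux (lam u : ℝ) : ℝ :=
  ∫ t in {t : ℝ | 1 < t ∧ u * t < 1}, ((t - 1) * (1 - u * t)) ^ (lam - 1) / t ^ (lam + 1)

/-- The kernel `H_lam(x, y)`, for `x, y` in `(-1, 1)`. -/
def kernelH (lam x y : ℝ) : ℝ :=
  if lam = 0 then 1 - x * y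
  else
    Real.Gamma (2 * lam) * (1 - x * y + √((1 - x ^ 2) * (1 - y ^ 2))) ^ lam
      / ((2 : ℝ) ^ (3 * lam - 1) * Real.Gamma lam ^ 2
          * ((1 - x ^ 2) * (1 - y ^ 2)) ^ (lam - 1 / 2))
      * kernelAux lam ((x - y) ^ 2 / (1 - x * y + √((1 - x ^ 2) * (1 - y ^ 2))) ^ 2)

/-- The integrand `((φ(x) - φ(y)) / (x - y))^2 H_lam(x, y)`. -/
def quotientEnergyDensity (lam : ℝ) (φ : ℝ → ℝ) (p : ℝ × ℝ) : ℝ :=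
  ((φ p.1 - φ p.2) / (p.1 - p.2)) ^ 2 * kernelH lam p.1 p.2

/-- The Gegenbauer polynomial `C_n^lam` at `x`: for `lam ≠ 0` the `n`-th Taylor coefficient at
`r = 0` of `(1 - 2 r x + r^2)^(-lam)`; for `lam = 0` it is `T_n(x) / n` when `n ≥ 1`, and `1`
when `n = 0`. -/
def poly (lam : ℝ) (n : ℕ) (x : ℝ) : ℝ :=
  if lam = 0 then
    if n = 0 then 1 else (Polynomial.Chebyshev.T ℝ (n : ℤ)).eval x / n
  else iteratedDeriv n (fun r : ℝ => (1 - 2 * r * x + r ^ 2) ^ (-lam)) 0 / (n.factorial : ℝ)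

/-- The Gegenbauer polynomials normalized in `L²(ν_lam)`. -/
def normPoly (lam : ℝ) (n : ℕ) (x : ℝ) : ℝ :=
  poly lam n x / √(∫ z, poly lam n z ^ 2 ∂(law lam))

/-- The coefficients of `φ` in the basis of normalized Gegenbauer polynomials. -/
def coeff (lam : ℝ) (φ : ℝ → ℝ) (n : ℕ) : ℝ :=
  ∫ x, φ x * normPoly lam n x ∂(law lam)

/-- The derivative of a function on `[-1, 1]` (one-sided at the end points). -/
def der (φ : ℝ → ℝ) : ℝ → ℝ := derivWithin φ (Icc (-1) 1)

/-- The Jacobi operator `L_lam f = -(1 - x^2) f'' + (2 lam + 1) x f'`. -/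
def jacobiOp (lam : ℝ) (f : ℝ → ℝ) (x : ℝ) : ℝ :=
  -(1 - x ^ 2) * der (der f) x + (2 * lam + 1) * x * der f x

end Gegenbauer

end

open Filter Topology

noncomputable section

namespace Gegenbauer

/-! In the basis of normalized Gegenbauer polynomials, `L`, `N` and `1 - P` are diagonal, with
eigenvalues `n (n + 2 lam)`, `n` and `1` for `n ≥ 1`, all zero at `n = 0`. Since `n (n + 2 lam) ≥ (2
lam + 1) n` and `n ≥ 1` for integers `n ≥ 1`, both inequalities are immediate once each quantity is
identified with its spectral sum. Parseval (`hasSum_coeff_sq`) gives the variance, Bessel for `φ'`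
(`sum_coeff_sq_le_integral_deriv_sq`) gives the Dirichlet form. The substance is that the double
integral is twice the form of `N` (`lintegral_quotientEnergyDensity`).

If `2 lam + 2 = d` is an integer, `law lam` is the law of one coordinate of a uniform point of the
unit sphere of `ℝ^d`, and `disc lam` that of its projection to a plane. For real `lam ≥ 0` the
rotation invariance survives as `map_refl_disc`. Averaging a polynomial of degree `n` over the
second coordinate then defines a symmetric operator that does not raise degrees; hence it is
diagonal, with eigenvalue `Z_n(w)`, where `Z_n` is the polynomial with value `1` at `1`
(`integral_ang_zonal`). So the energy of two points with inner product `w` is `∑ 2 c_n² (1 -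
Z_n(w))` (`hasSum_translateEnergy`).

Integrated over `w` with the weight `2^(-lam) (1 - w)^(-lam - 1)`, the factor `1 - Z_n(w)` becomes
exactly `n` (`lintegral_jump_zonal`). On the other side, `kernelH` is `(x - y)²` times the angular
average of the same weight (`kernelH_eq_sq_mul_integral_ang`). A second change of variables in the
same integral gives the average of `(1 - x y - s z)^(1 - lam)`, from which continuity up to the
boundary is read off. -/

/-! ### Jacobi weights and Beta integrals. -/

/-- The Jacobi weight `(1 - x)^α (1 + x)^β`. -/
def jac (α β x : ℝ) : ℝ := (1 - x) ^ α * (1 + x) ^ β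

@[fun_prop]
lemma measurable_jac (α β : ℝ) : Measurable (jac α β) := by
  unfold jac; fun_prop

lemma jac_pos (α β : ℝ) {x : ℝ} (hx : x ∈ Ioo (-1 : ℝ) 1) : 0 < jac α β x :=
  mul_pos (Real.rpow_pos_of_pos (by linarith [hx.2]) _) (Real.rpow_pos_of_pos (by linarith [hx.1]) _)

lemma one_sub_sq_rpow (α : ℝ) {x : ℝ} (hx : x ∈ Icc (-1 : ℝ) 1) :
    (1 - x ^ 2) ^ α = jac α α x := by
  rw [jac, ← Real.mul_rpow (by linarith [hx.2]) (by linarith [hx.1])]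
  congr 1; ring

/-- Both claims are read off from the Beta density having total mass one. -/
lemma beta_integrableOn_and_integral {a b : ℝ} (ha : 0 < a) (hb : 0 < b) :
    IntegrableOn (fun x : ℝ => x ^ (a - 1) * (1 - x) ^ (b - 1)) (Ioo 0 1) ∧
    ∫ x in Ioo (0 : ℝ) 1, x ^ (a - 1) * (1 - x) ^ (b - 1) = beta a b := by
  have h := lintegral_betaPDF_eq_one ha hb
  rw [lintegral_betaPDF] at h
  have hB := beta_pos ha hb
  have hnn : 0 ≤ᵐ[volume.restrict (Ioo (0 : ℝ) 1)]
      fun x : ℝ => 1 / beta a b * x ^ (a - 1) * (1 - x) ^ (b - 1) := by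
    refine ae_restrict_of_forall_mem measurableSet_Ioo fun x hx => ?_
    have h1 : 0 < 1 - x := by linarith [hx.2]
    have := hx.1
    simp only [Pi.zero_apply]; positivity
  have hm : AEStronglyMeasurable (fun x : ℝ => 1 / beta a b * x ^ (a - 1) * (1 - x) ^ (b - 1))
      (volume.restrict (Ioo (0 : ℝ) 1)) :=
    Measurable.aestronglyMeasurable (by fun_prop)
  have hint : IntegrableOn (fun x : ℝ => 1 / beta a b * x ^ (a - 1) * (1 - x) ^ (b - 1))
      (Ioo 0 1) :=
    (lintegral_ofReal_ne_top_iff_integrable hm hnn).1 (by rw [h]; exact ENNReal.one_ne_top)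
  have hval : ∫ x in Ioo (0 : ℝ) 1, 1 / beta a b * x ^ (a - 1) * (1 - x) ^ (b - 1) = 1 := by
    rw [integral_eq_lintegral_of_nonneg_ae hnn hm, h]; simp
  simp_rw [mul_assoc, one_div] at hint hval
  constructor
  · have := hint.const_mul (beta a b)
    refine this.congr (Eventually.of_forall fun x => ?_)
    simp [mul_inv_cancel_left₀ hB.ne']
  · rw [integral_const_mul] at hval
    field_simp at hval
    exact hval

lemma image_two_mul_sub_one : (fun v : ℝ => 2 * v - 1) '' Ioo 0 1 = Ioo (-1 : ℝ) 1 := by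
  ext x
  constructor
  · rintro ⟨v, hv, rfl⟩
    exact ⟨by linarith [hv.1], by linarith [hv.2]⟩
  · intro hx
    exact ⟨(x + 1) / 2, ⟨by linarith [hx.1], by linarith [hx.2]⟩, by ring⟩

lemma jac_affine (α β : ℝ) {v : ℝ} (hv : v ∈ Ioo (0 : ℝ) 1) :
    |(2 : ℝ)| • jac α β (2 * v - 1)
      = 2 ^ (α + β + 1) * (v ^ (β + 1 - 1) * (1 - v) ^ (α + 1 - 1)) := by
  have h1 : 0 < 1 - v := by linarith [hv.2]
  rw [jac, show 1 - (2 * v - 1) = 2 * (1 - v) by ring, show 1 + (2 * v - 1) = 2 * v by ring,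
    Real.mul_rpow (by norm_num) h1.le, Real.mul_rpow (by norm_num) hv.1.le,
    Real.rpow_add (by norm_num), Real.rpow_add (by norm_num), Real.rpow_one, add_sub_cancel_right,
    add_sub_cancel_right]
  simp only [abs_two, smul_eq_mul]
  ring

lemma integrableOn_jac {α β : ℝ} (hα : -1 < α) (hβ : -1 < β) :
    IntegrableOn (jac α β) (Ioo (-1) 1) := by
  rw [← image_two_mul_sub_one, integrableOn_image_iff_integrableOn_abs_deriv_smul
    (f' := fun _ => 2) measurableSet_Ioo
    (fun x _ => by simpa using (((hasDerivAt_id x).const_mul 2).sub_const 1).hasDerivWithinAt)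
    (fun x _ y _ h => by simpa using h)]
  refine IntegrableOn.congr_fun ?_ (fun v hv => (jac_affine α β hv).symm) measurableSet_Ioo
  exact (beta_integrableOn_and_integral (by linarith) (by linarith)).1.const_mul _

lemma integral_jac {α β : ℝ} (hα : -1 < α) (hβ : -1 < β) :
    ∫ x in Ioo (-1) 1, jac α β x = 2 ^ (α + β + 1) * beta (β + 1) (α + 1) := by
  rw [← image_two_mul_sub_one, integral_image_eq_integral_abs_deriv_smul
    (f' := fun _ => 2) measurableSet_Ioo
    (fun x _ => by simpa using (((hasDerivAt_id x).const_mul 2).sub_const 1).hasDerivWithinAt)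
    (fun x _ y _ h => by simpa using h),
    setIntegral_congr_fun measurableSet_Ioo (fun v hv => jac_affine α β hv), integral_const_mul,
    (beta_integrableOn_and_integral (by linarith) (by linarith)).2]

lemma integrableOn_jac_mul {α β : ℝ} (hα : -1 < α) (hβ : -1 < β) {g : ℝ → ℝ}
    (hg : ContinuousOn g (Icc (-1) 1)) :
    IntegrableOn (fun x => jac α β x * g x) (Ioo (-1) 1) := by
  obtain ⟨C, hC⟩ := isCompact_Icc.exists_bound_of_continuousOn hg
  refine Integrable.mul_bdd (c := C) (integrableOn_jac hα hβ)
    ((hg.mono Ioo_subset_Icc_self).aestronglyMeasurable measurableSet_Ioo)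
    (ae_restrict_of_forall_mem measurableSet_Ioo fun x hx => hC x (Ioo_subset_Icc_self hx))

/-- The fundamental theorem of calculus for `(1 - x)^(α + 1) (1 + x)^(β + 1) g`. -/
lemma integral_jac_deriv {α β : ℝ} (hα : -1 < α) (hβ : -1 < β) {g g' : ℝ → ℝ}
    (hg : ContinuousOn g (Icc (-1) 1)) (hg' : ContinuousOn g' (Icc (-1) 1))
    (hd : ∀ x ∈ Ioo (-1 : ℝ) 1, HasDerivAt g (g' x) x) :
    ∫ x in Ioo (-1) 1, jac α β x *
      (((β + 1) * (1 - x) - (α + 1) * (1 + x)) * g x + (1 - x ^ 2) * g' x) = 0 := by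
  have key : ∀ x ∈ Ioo (-1 : ℝ) 1, HasDerivAt (fun x => jac (α + 1) (β + 1) x * g x)
      (jac α β x * (((β + 1) * (1 - x) - (α + 1) * (1 + x)) * g x + (1 - x ^ 2) * g' x)) x := by
    intro x hx
    have h1 : 0 < 1 - x := by linarith [hx.2]
    have h2 : 0 < 1 + x := by linarith [hx.1]
    have e1 := ((hasDerivAt_id x).const_sub 1).rpow_const (p := α + 1) (Or.inl h1.ne')
    have e2 := ((hasDerivAt_id x).const_add 1).rpow_const (p := β + 1) (Or.inl h2.ne')
    have := (e1.mul e2).mul (hd x hx)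
    refine this.congr_deriv ?_
    simp only [jac, id, Real.rpow_add_one h1.ne', Real.rpow_add_one h2.ne', add_sub_cancel_right,
      Pi.mul_apply]
    ring
  have hcont : ContinuousOn (fun x => jac (α + 1) (β + 1) x * g x) (Icc (-1) 1) := by
    refine ContinuousOn.mul ?_ hg
    unfold jac
    refine ContinuousOn.mul ?_ ?_
    · exact (continuousOn_const.sub continuousOn_id).rpow_const fun x _ => Or.inr (by linarith)
    · exact (continuousOn_const.add continuousOn_id).rpow_const fun x _ => Or.inr (by linarith)
  have hcont' : ContinuousOn (fun x => ((β + 1) * (1 - x) - (α + 1) * (1 + x)) * g x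
      + (1 - x ^ 2) * g' x) (Icc (-1) 1) := by fun_prop
  have := intervalIntegral.integral_eq_sub_of_hasDerivAt_of_le (by norm_num) hcont key
    ((intervalIntegrable_iff_integrableOn_Ioo_of_le (by norm_num)).2
      (integrableOn_jac_mul hα hβ hcont'))
  rw [intervalIntegral.integral_of_le (by norm_num), integral_Ioc_eq_integral_Ioo] at this
  rw [this]
  simp [jac, Real.zero_rpow (show α + 1 ≠ 0 by linarith), Real.zero_rpow (show β + 1 ≠ 0 by linarith)]

/-! ### The Gegenbauer law as a probability measure. -/

/-- The normalizing constant of the Gegenbauer law. -/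
def cst (lam : ℝ) : ℝ :=
  (2 : ℝ) ^ (2 * lam) * Real.Gamma (lam + 1) ^ 2 / (Real.pi * Real.Gamma (2 * lam + 1))

lemma cst_pos {lam : ℝ} (hl : 0 ≤ lam) : 0 < cst lam := by
  have h1 := Real.Gamma_pos_of_pos (show 0 < lam + 1 by linarith)
  have h2 := Real.Gamma_pos_of_pos (show 0 < 2 * lam + 1 by linarith)
  have := Real.pi_pos
  unfold cst; positivity

/-- The density of the Gegenbauer law on `(-1, 1)`. -/
def dens (lam x : ℝ) : ℝ := cst lam * jac (lam - 1 / 2) (lam - 1 / 2) x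

@[fun_prop]
lemma measurable_dens (lam : ℝ) : Measurable (dens lam) := by unfold dens; fun_prop

lemma dens_pos {lam : ℝ} (hl : 0 ≤ lam) {x : ℝ} (hx : x ∈ Ioo (-1 : ℝ) 1) : 0 < dens lam x :=
  mul_pos (cst_pos hl) (jac_pos _ _ hx)

lemma law_eq (lam : ℝ) :
    law lam = (volume.restrict (Ioo (-1 : ℝ) 1)).withDensity fun x => ENNReal.ofReal (dens lam x) := by
  unfold law
  rw [restrict_Ioo_eq_restrict_Icc]
  refine withDensity_congr_ae (ae_restrict_of_forall_mem measurableSet_Icc fun x hx => ?_)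
  simp only [one_sub_sq_rpow _ hx, dens, cst]

lemma ae_law_mem (lam : ℝ) : ∀ᵐ x ∂(law lam), x ∈ Ioo (-1 : ℝ) 1 := by
  rw [law_eq]
  exact (withDensity_absolutelyContinuous _ _).ae_le (ae_restrict_mem measurableSet_Ioo)

lemma lintegral_law (lam : ℝ) (f : ℝ → ENNReal) :
    ∫⁻ x, f x ∂(law lam) = ∫⁻ x in Ioo (-1) 1, ENNReal.ofReal (dens lam x) * f x := by
  rw [law_eq, lintegral_withDensity_eq_lintegral_mul_non_measurable _ (by fun_prop)
    (Eventually.of_forall fun _ => ENNReal.ofReal_lt_top)]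
  rfl

lemma integral_law {lam : ℝ} (hl : 0 ≤ lam) (f : ℝ → ℝ) :
    ∫ x, f x ∂(law lam) = ∫ x in Ioo (-1) 1, dens lam x * f x := by
  rw [law_eq, integral_withDensity_eq_integral_toReal_smul (by fun_prop)
    (Eventually.of_forall fun _ => ENNReal.ofReal_lt_top)]
  refine setIntegral_congr_fun measurableSet_Ioo fun x hx => ?_
  simp only [ENNReal.toReal_ofReal (dens_pos hl hx).le, smul_eq_mul]

lemma integrable_law_iff {lam : ℝ} (hl : 0 ≤ lam) (f : ℝ → ℝ) :
    Integrable f (law lam) ↔ IntegrableOn (fun x => dens lam x * f x) (Ioo (-1) 1) := by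
  rw [law_eq, integrable_withDensity_iff_integrable_smul' (by fun_prop)
    (Eventually.of_forall fun _ => ENNReal.ofReal_lt_top)]
  refine integrableOn_congr_fun (fun x hx => ?_) measurableSet_Ioo
  simp only [ENNReal.toReal_ofReal (dens_pos hl hx).le, smul_eq_mul]

/-- Legendre's duplication formula at `lam + 1 / 2` turns the constant of the statement into the
reciprocal of a Beta integral. -/
lemma cst_mul_beta {lam : ℝ} (hl : 0 ≤ lam) :
    cst lam * (2 ^ (2 * lam) * beta (lam + 1 / 2) (lam + 1 / 2)) = 1 := by
  have h1 := Real.Gamma_pos_of_pos (show 0 < lam + 1 by linarith)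
  have h2 := Real.Gamma_pos_of_pos (show 0 < 2 * lam + 1 by linarith)
  have h3 := Real.Gamma_mul_Gamma_add_half (lam + 1 / 2)
  rw [show lam + 1 / 2 + 1 / 2 = lam + 1 by ring, show 2 * (lam + 1 / 2) = 2 * lam + 1 by ring,
    show 1 - (2 * lam + 1) = - (2 * lam) by ring, Real.rpow_neg (by norm_num)] at h3
  have h4 : Real.Gamma (lam + 1 / 2)
      = Real.Gamma (2 * lam + 1) * (2 ^ (2 * lam))⁻¹ * √Real.pi / Real.Gamma (lam + 1) := by
    rw [← h3]; field_simp
  have h5 := Real.sq_sqrt Real.pi_pos.le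
  have h6 : (0 : ℝ) < 2 ^ (2 * lam) := by positivity
  rw [cst, beta, show lam + 1 / 2 + (lam + 1 / 2) = 2 * lam + 1 by ring, h4]
  have := Real.pi_pos
  field_simp
  exact h5

instance isProbabilityMeasure_law (lam : ℝ) [Fact (0 ≤ lam)] : IsProbabilityMeasure (law lam) := by
  have hl : 0 ≤ lam := Fact.out
  constructor
  have := lintegral_law lam (fun _ => 1)
  rw [lintegral_one] at this
  rw [this]
  simp only [mul_one]
  have h1 : IntegrableOn (dens lam) (Ioo (-1) 1) :=
    (integrableOn_jac (by linarith) (by linarith)).const_mul _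
  rw [← ofReal_integral_eq_lintegral_ofReal h1
    (ae_restrict_of_forall_mem measurableSet_Ioo fun x hx => (dens_pos hl hx).le)]
  unfold dens
  rw [integral_const_mul, integral_jac (by linarith) (by linarith),
    show lam - 1 / 2 + (lam - 1 / 2) + 1 = 2 * lam by ring,
    show lam - 1 / 2 + 1 = lam + 1 / 2 by ring, cst_mul_beta hl]
  simp

lemma integrable_law_of_continuousOn {lam : ℝ} (hl : 0 ≤ lam) {f : ℝ → ℝ}
    (hf : ContinuousOn f (Icc (-1) 1)) : Integrable f (law lam) := by
  rw [integrable_law_iff hl]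
  have := (integrableOn_jac_mul (α := lam - 1 / 2) (β := lam - 1 / 2)
    (by linarith) (by linarith) hf).const_mul (cst lam)
  refine this.congr (Eventually.of_forall fun x => ?_)
  simp only [dens, mul_assoc]

instance nullSingletonClass_law (lam : ℝ) : NullSingletonClass (law lam) := by
  rw [law_eq]; infer_instance

/-! ### Gegenbauer polynomials by recurrence; ladder relations and differential equation. -/

open Polynomial in
/-- The Gegenbauer polynomials normalized by the value `1` at `1`. -/
def zonal (lam : ℝ) : ℕ → ℝ[X]
  | 0 => 1
  | 1 => X
  | (n + 2) => C ((n + 1 + 2 * lam)⁻¹) *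
      (C (2 * (n + 1 + lam)) * X * zonal lam (n + 1) - C ((n : ℝ) + 1) * zonal lam n)

@[simp] lemma zonal_zero (lam : ℝ) : zonal lam 0 = 1 := rfl
@[simp] lemma zonal_one (lam : ℝ) : zonal lam 1 = Polynomial.X := rfl

section
variable {lam : ℝ} (hl : 0 ≤ lam)
include hl

lemma zonal_three_term (n : ℕ) (x : ℝ) :
    (n + 1 + 2 * lam) * (zonal lam (n + 2)).eval x
      = 2 * (n + 1 + lam) * x * (zonal lam (n + 1)).eval x - (n + 1) * (zonal lam n).eval x := by
  have : (n : ℝ) + 1 + 2 * lam ≠ 0 := by positivity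
  rw [zonal]
  simp only [Polynomial.eval_mul, Polynomial.eval_C, Polynomial.eval_sub, Polynomial.eval_X]
  field_simp

lemma zonal_three_term_derivative (n : ℕ) (x : ℝ) :
    (n + 1 + 2 * lam) * (zonal lam (n + 2)).derivative.eval x
      = 2 * (n + 1 + lam) * ((zonal lam (n + 1)).eval x + x * (zonal lam (n + 1)).derivative.eval x)
        - (n + 1) * (zonal lam n).derivative.eval x := by
  have : (n : ℝ) + 1 + 2 * lam ≠ 0 := by positivity
  rw [zonal]
  simp only [Polynomial.eval_mul, Polynomial.eval_C, Polynomial.eval_sub, Polynomial.eval_X,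
    Polynomial.derivative_mul, Polynomial.derivative_C, Polynomial.derivative_sub,
    Polynomial.derivative_X, Polynomial.eval_add, Polynomial.eval_zero, Polynomial.eval_one]
  field_simp
  ring

lemma zonal_eval_one (n : ℕ) : (zonal lam n).eval 1 = 1 := by
  induction n using Nat.twoStepInduction with
  | zero => simp
  | one => simp
  | more n h1 h2 =>
    have h := zonal_three_term hl n 1
    rw [h1, h2] at h
    have : (n : ℝ) + 1 + 2 * lam ≠ 0 := by positivity
    apply mul_left_cancel₀ this
    rw [h]; ring

/-- The two relations must be proved in one induction: the next lowering relation uses both, through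
the differentiated three-term recurrence, and the next raising relation is the previous lowering one
combined with the recurrence. -/
lemma zonal_ladder (n : ℕ) (x : ℝ) :
    (1 - x ^ 2) * (zonal lam (n + 1)).derivative.eval x
      = (n + 1) * ((zonal lam n).eval x - x * (zonal lam (n + 1)).eval x) ∧
    (1 - x ^ 2) * (zonal lam n).derivative.eval x
      = (n + 2 * lam) * (x * (zonal lam n).eval x - (zonal lam (n + 1)).eval x) := by
  induction n with
  | zero => simp; ring
  | succ n ih =>
    obtain ⟨hA, hB⟩ := ih
    have h3 := zonal_three_term hl n x
    have h4 := zonal_three_term_derivative hl n x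
    have h0 : (n : ℝ) + 1 + 2 * lam ≠ 0 := by positivity
    push_cast
    constructor
    · apply mul_left_cancel₀ h0
      linear_combination (1 - x ^ 2) * h4 + 2 * (n + 1 + lam) * x * hA - (n + 1) * hB
        + (n + 2) * x * h3
    · linear_combination hA + h3

/-- Differentiating the lowering relation and eliminating the lower degree by the raising one gives
the equation multiplied by `1 - x ^ 2`, which is why the end points are excluded. -/
lemma zonal_ode (n : ℕ) {x : ℝ} (hx : x ∈ Ioo (-1 : ℝ) 1) :
    -(1 - x ^ 2) * (zonal lam n).derivative.derivative.eval x
      + (2 * lam + 1) * x * (zonal lam n).derivative.eval x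
      = n * (n + 2 * lam) * (zonal lam n).eval x := by
  cases n with
  | zero => simp
  | succ n =>
    have hA : (1 - Polynomial.X ^ 2) * (zonal lam (n + 1)).derivative
        = Polynomial.C ((n : ℝ) + 1) * (zonal lam n - Polynomial.X * zonal lam (n + 1)) := by
      refine Polynomial.funext fun y => ?_
      simpa using (zonal_ladder hl n y).1
    have hA' := congrArg (fun p => Polynomial.eval x (Polynomial.derivative p)) hA
    simp only [Polynomial.derivative_mul, Polynomial.derivative_sub, Polynomial.derivative_one,
      Polynomial.derivative_X_pow, Polynomial.derivative_C, Polynomial.derivative_X,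
      Polynomial.eval_add, Polynomial.eval_mul, Polynomial.eval_sub, Polynomial.eval_zero,
      Polynomial.eval_C, Polynomial.eval_X, Polynomial.eval_pow, Polynomial.eval_one] at hA'
    obtain ⟨h1, h2⟩ := zonal_ladder hl n x
    have h0 : 1 - x ^ 2 ≠ 0 := by nlinarith [hx.1, hx.2]
    push_cast at hA' ⊢
    apply mul_left_cancel₀ h0
    linear_combination -(1 - x ^ 2) * hA' - (n + 1) * h2 + (n + 2 * lam) * x * h1

/-- Positivity of the coefficient makes the degree exact, so that the first `n + 1` polynomials span
all polynomials of degree at most `n`. -/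
lemma zonal_natDegree_le_and_coeff_pos (n : ℕ) :
    (zonal lam n).natDegree ≤ n ∧ 0 < (zonal lam n).coeff n := by
  induction n using Nat.twoStepInduction with
  | zero => simp
  | one => simp
  | more n h1 h2 =>
    have hz : (zonal lam n).coeff (n + 2) = 0 :=
      Polynomial.coeff_eq_zero_of_natDegree_lt (by omega)
    constructor
    · rw [zonal]
      refine (Polynomial.natDegree_C_mul_le _ _).trans ?_
      refine (Polynomial.natDegree_sub_le _ _).trans (max_le ?_ ?_)
      · refine Polynomial.natDegree_mul_le.trans ?_
        have := Polynomial.natDegree_C_mul_le (2 * ((n : ℝ) + 1 + lam)) Polynomial.X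
        rw [Polynomial.natDegree_X] at this
        omega
      · exact (Polynomial.natDegree_C_mul_le _ _).trans (by omega)
    · rw [zonal, Polynomial.coeff_C_mul, Polynomial.coeff_sub, Polynomial.coeff_C_mul, hz,
        mul_assoc, Polynomial.coeff_C_mul, Polynomial.coeff_X_mul]
      have := h2.2
      simp only [mul_zero, sub_zero]
      positivity

lemma exists_zonal_expansion (n : ℕ) (p : Polynomial ℝ) (hp : p.natDegree ≤ n) :
    ∃ b : ℕ → ℝ, p = ∑ m ∈ Finset.range (n + 1), Polynomial.C (b m) * zonal lam m := by
  induction n generalizing p with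
  | zero =>
    refine ⟨fun _ => p.coeff 0, ?_⟩
    simpa using Polynomial.eq_C_of_natDegree_le_zero hp
  | succ n ih =>
    obtain ⟨h1, h2⟩ := zonal_natDegree_le_and_coeff_pos hl (n + 1)
    set b₀ := p.coeff (n + 1) / (zonal lam (n + 1)).coeff (n + 1) with hb
    obtain ⟨b, hb'⟩ := ih (p - Polynomial.C b₀ * zonal lam (n + 1)) (by
      rw [Polynomial.natDegree_le_iff_coeff_eq_zero]
      intro N hN
      rw [Polynomial.coeff_sub, Polynomial.coeff_C_mul]
      rcases Nat.lt_or_ge (n + 1) N with h | h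
      · rw [Polynomial.coeff_eq_zero_of_natDegree_lt (hp.trans_lt h),
          Polynomial.coeff_eq_zero_of_natDegree_lt (h1.trans_lt h)]
        simp
      · obtain rfl : N = n + 1 := by omega
        rw [hb, div_mul_cancel₀ _ h2.ne', sub_self])
    refine ⟨fun m => if m = n + 1 then b₀ else b m, ?_⟩
    rw [Finset.sum_range_succ]
    simp only [if_true]
    rw [sub_eq_iff_eq_add] at hb'
    conv_lhs => rw [hb']
    congr 1
    refine Finset.sum_congr rfl fun m hm => ?_
    rw [if_neg (by have := Finset.mem_range.1 hm; omega)]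

end

/-! ### The generating function and the link with `poly`. -/

lemma one_sub_two_mul_add_sq_pos {x : ℝ} (hx : x ∈ Ioo (-1 : ℝ) 1) (r : ℝ) :
    0 < 1 - 2 * r * x + r ^ 2 := by nlinarith [sq_nonneg (r - x), hx.1, hx.2]

section
variable {lam x : ℝ} (hx : x ∈ Ioo (-1 : ℝ) 1)
include hx

lemma hasDerivAt_iteratedDeriv_generating (n : ℕ) (r : ℝ) :
    HasDerivAt (iteratedDeriv n fun r : ℝ => (1 - 2 * r * x + r ^ 2) ^ (-lam))
      (iteratedDeriv (n + 1) (fun r : ℝ => (1 - 2 * r * x + r ^ 2) ^ (-lam)) r) r := by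
  have h : ContDiff ℝ ⊤ fun r : ℝ => (1 - 2 * r * x + r ^ 2) ^ (-lam) :=
    ContDiff.rpow_const_of_ne (by fun_prop) fun r => (one_sub_two_mul_add_sq_pos hx r).ne'
  have := (h.differentiable_iteratedDeriv n (by exact_mod_cast WithTop.coe_lt_top _)) r
  rw [iteratedDeriv_succ]
  exact this.hasDerivAt

lemma generating_deriv (r : ℝ) :
    (1 - 2 * r * x + r ^ 2)
        * iteratedDeriv 1 (fun r : ℝ => (1 - 2 * r * x + r ^ 2) ^ (-lam)) r
      = 2 * lam * (x - r) * (1 - 2 * r * x + r ^ 2) ^ (-lam) := by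
  have h0 := one_sub_two_mul_add_sq_pos hx r
  have hQ : HasDerivAt (fun r : ℝ => 1 - 2 * r * x + r ^ 2) (2 * (r - x)) r := by
    have := ((((hasDerivAt_id r).const_mul 2).mul_const x).const_sub 1).add ((hasDerivAt_id r).pow 2)
    refine this.congr_deriv ?_
    simp only [id]; push_cast; ring
  rw [iteratedDeriv_one, (hQ.rpow_const (Or.inl h0.ne')).deriv, Real.rpow_sub_one h0.ne']
  field_simp
  ring

/-- The first-order equation of the generating function, differentiated `n + 1` times; three terms
remain because its coefficients have degree at most two in `r`. Only `r = 0` is needed later, but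
the induction differentiates the identity and so needs all `r`. -/
lemma generating_recurrence (n : ℕ) : ∀ r : ℝ,
    (1 - 2 * r * x + r ^ 2)
        * iteratedDeriv (n + 2) (fun r : ℝ => (1 - 2 * r * x + r ^ 2) ^ (-lam)) r
      + 2 * (n + 1 + lam) * (r - x)
        * iteratedDeriv (n + 1) (fun r : ℝ => (1 - 2 * r * x + r ^ 2) ^ (-lam)) r
      + (n + 1) * (n + 2 * lam)
        * iteratedDeriv n (fun r : ℝ => (1 - 2 * r * x + r ^ 2) ^ (-lam)) r = 0 := by
  have hQ : ∀ r, HasDerivAt (fun r : ℝ => 1 - 2 * r * x + r ^ 2) (2 * (r - x)) r := by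
    intro r
    have := ((((hasDerivAt_id r).const_mul 2).mul_const x).const_sub 1).add ((hasDerivAt_id r).pow 2)
    refine this.congr_deriv ?_
    simp only [id]; push_cast; ring
  have hL : ∀ (c r : ℝ), HasDerivAt (fun r : ℝ => c * (r - x)) c r := fun c r => by
    simpa using ((hasDerivAt_id r).sub_const x).const_mul c
  set D := fun n => iteratedDeriv n (fun r : ℝ => (1 - 2 * r * x + r ^ 2) ^ (-lam)) with hD
  have hd : ∀ n r, HasDerivAt (D n) (D (n + 1) r) r := hasDerivAt_iteratedDeriv_generating hx
  change ∀ r, _ * D (n + 2) r + _ * D (n + 1) r + _ * D n r = 0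
  induction n with
  | zero =>
    intro r
    have h1 : (fun r => (1 - 2 * r * x + r ^ 2) * D 1 r + 2 * lam * (r - x) * D 0 r)
        = fun _ => 0 := by
      funext r
      have := generating_deriv (lam := lam) hx r
      simp only [hD, iteratedDeriv_zero]
      rw [this]; ring
    have h2 := ((hQ r).mul (hd 1 r)).add ((hL (2 * lam) r).mul (hd 0 r))
    have h3 : HasDerivAt (fun r => (1 - 2 * r * x + r ^ 2) * D 1 r + 2 * lam * (r - x) * D 0 r) 0 r := by
      rw [h1]; exact hasDerivAt_const r 0
    have := h2.unique h3
    push_cast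
    linear_combination this
  | succ n ih =>
    intro r
    have h1 : (fun r => (1 - 2 * r * x + r ^ 2) * D (n + 2) r
        + 2 * (n + 1 + lam) * (r - x) * D (n + 1) r + (n + 1) * (n + 2 * lam) * D n r)
        = fun _ => 0 := funext ih
    have h2 := (((hQ r).mul (hd (n + 2) r)).add ((hL (2 * (n + 1 + lam)) r).mul (hd (n + 1) r))).add
      ((hd n r).const_mul ((n + 1) * (n + 2 * lam)))
    have h3 : HasDerivAt (fun r => (1 - 2 * r * x + r ^ 2) * D (n + 2) r
        + 2 * (n + 1 + lam) * (r - x) * D (n + 1) r + (n + 1) * (n + 2 * lam) * D n r) 0 r := by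
      rw [h1]; exact hasDerivAt_const r 0
    have := h2.unique h3
    push_cast
    linear_combination this

end

/-- The value at `1` of the Gegenbauer polynomial of degree `n`, for `lam > 0`. -/
def valueAtOne (lam : ℝ) (n : ℕ) : ℝ := ∏ i ∈ Finset.range n, ((i + 2 * lam) / (i + 1))

/-- At `r = 0` the Taylor coefficients obey the recurrence of `zonal` up to the rescaling by the
value at `1`. -/
lemma poly_eq_of_pos {lam : ℝ} (hl : 0 < lam) {x : ℝ} (hx : x ∈ Ioo (-1 : ℝ) 1) (n : ℕ) :
    poly lam n x = valueAtOne lam n * (zonal lam n).eval x := by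
  have hg := generating_deriv (lam := lam) hx 0
  have hr := fun n => generating_recurrence (lam := lam) hx n 0
  simp only [poly, if_neg hl.ne']
  set D := fun n => iteratedDeriv n (fun r : ℝ => (1 - 2 * r * x + r ^ 2) ^ (-lam)) 0 with hD
  change D n / _ = _
  change _ * D 1 = _ at hg
  change ∀ n, _ * D (n + 2) + _ * D (n + 1) + _ * D n = 0 at hr
  have hv : ∀ n, valueAtOne lam (n + 1) = valueAtOne lam n * ((n + 2 * lam) / (n + 1)) :=
    fun n => Finset.prod_range_succ _ _
  induction n using Nat.twoStepInduction with
  | zero => simp [hD, valueAtOne]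
  | one =>
    norm_num at hg
    simp [valueAtOne, hg]
  | more n h1 h2 =>
    have h3 := zonal_three_term hl.le n x
    have h4 := hr n
    have hf : (n.factorial : ℝ) ≠ 0 := by positivity
    rw [Nat.factorial_succ] at h2
    rw [Nat.factorial_succ, Nat.factorial_succ]
    rw [hv] at h2
    rw [hv, hv]
    push_cast at h2 ⊢
    have e1 : D n = valueAtOne lam n * (zonal lam n).eval x * n.factorial := by
      rw [← h1]; field_simp
    have e2 : D (n + 1) = valueAtOne lam n * (n + 2 * lam) * (zonal lam (n + 1)).eval x
        * n.factorial := by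
      field_simp at h2
      rw [h2]; ring
    rw [e1, e2] at h4
    have h0 : (n : ℝ) + 1 + 2 * lam ≠ 0 := by positivity
    have e3 : D (n + 2) = valueAtOne lam n * (n + 2 * lam) * (n + 1 + 2 * lam)
        * (zonal lam (n + 2)).eval x * n.factorial := by
      linear_combination h4 - valueAtOne lam n * (n + 2 * lam) * n.factorial * h3
    rw [e3]
    field_simp

lemma chebyshev_eq_zonal (n : ℕ) : Polynomial.Chebyshev.T ℝ (n : ℤ) = zonal 0 n := by
  induction n using Nat.twoStepInduction with
  | zero => simp
  | one => simp
  | more n h1 h2 =>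
    refine Polynomial.funext fun x => ?_
    have h3 := zonal_three_term le_rfl n x
    have h0 : (n : ℝ) + 1 ≠ 0 := by positivity
    push_cast at h2 ⊢
    rw [Polynomial.Chebyshev.T_add_two, h1, h2]
    apply mul_left_cancel₀ h0
    simp only [mul_zero, add_zero] at h3
    rw [h3]
    simp
    ring

/-- The constant may stay anonymous: being positive, it disappears in the `L²` normalization. -/
lemma exists_poly_eq {lam : ℝ} (hl : 0 ≤ lam) (n : ℕ) :
    ∃ k : ℝ, 0 < k ∧ ∀ x ∈ Ioo (-1 : ℝ) 1, poly lam n x = k * (zonal lam n).eval x := by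
  rcases hl.eq_or_lt with rfl | hl
  · rcases Nat.eq_zero_or_pos n with rfl | hn
    · exact ⟨1, one_pos, fun x _ => by simp [poly]⟩
    · refine ⟨1 / n, by positivity, fun x _ => ?_⟩
      simp only [poly, if_true, if_neg hn.ne', chebyshev_eq_zonal]
      ring
  · refine ⟨valueAtOne lam n, Finset.prod_pos fun i _ => by positivity, fun x hx => ?_⟩
    exact poly_eq_of_pos hl hx n

/-! ### Orthogonality, completeness, Parseval and Bessel. -/

section
variable {lam : ℝ} (hl : 0 ≤ lam)
include hl

/-- Integration by parts for the Jacobi operator. -/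
lemma integral_deriv_mul_law {u u' v v' : ℝ → ℝ}
    (hu : ContinuousOn u (Icc (-1) 1)) (hu' : ContinuousOn u' (Icc (-1) 1))
    (hv : ContinuousOn v (Icc (-1) 1)) (hv' : ContinuousOn v' (Icc (-1) 1))
    (hdu : ∀ x ∈ Ioo (-1 : ℝ) 1, HasDerivAt u (u' x) x)
    (hdv : ∀ x ∈ Ioo (-1 : ℝ) 1, HasDerivAt v (v' x) x) :
    ∫ x, u' x * v x * (1 - x ^ 2) ∂(law lam)
      = ∫ x, u x * (-(1 - x ^ 2) * v' x + (2 * lam + 1) * x * v x) ∂(law lam) := by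
  have h := integral_jac_deriv (α := lam - 1 / 2) (β := lam - 1 / 2) (by linarith) (by linarith)
    (hu.mul hv) ((hu'.mul hv).add (hu.mul hv')) (fun x hx => (hdu x hx).mul (hdv x hx))
  have h2 := integral_law hl fun x => u' x * v x * (1 - x ^ 2)
    - u x * (-(1 - x ^ 2) * v' x + (2 * lam + 1) * x * v x)
  have h3 : ∫ x in Ioo (-1) 1, dens lam x * (u' x * v x * (1 - x ^ 2)
      - u x * (-(1 - x ^ 2) * v' x + (2 * lam + 1) * x * v x)) = 0 := by
    rw [← mul_zero (cst lam), ← h, ← integral_const_mul]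
    refine integral_congr_ae (Eventually.of_forall fun x => ?_)
    simp only [dens, Pi.mul_apply, Pi.add_apply]; ring
  rw [h3, integral_sub (integrable_law_of_continuousOn hl (by fun_prop))
    (integrable_law_of_continuousOn hl (by fun_prop))] at h2
  linarith

lemma integral_zonal_derivative (n : ℕ) {u u' : ℝ → ℝ}
    (hu : ContinuousOn u (Icc (-1) 1)) (hu' : ContinuousOn u' (Icc (-1) 1))
    (hdu : ∀ x ∈ Ioo (-1 : ℝ) 1, HasDerivAt u (u' x) x) :
    ∫ x, u' x * (zonal lam n).derivative.eval x * (1 - x ^ 2) ∂(law lam)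
      = n * (n + 2 * lam) * ∫ x, u x * (zonal lam n).eval x ∂(law lam) := by
  rw [integral_deriv_mul_law hl hu hu' (v' := fun x => (zonal lam n).derivative.derivative.eval x)
    (by fun_prop) (by fun_prop) hdu (fun x _ => Polynomial.hasDerivAt _ x), ← integral_const_mul]
  refine integral_congr_ae ((ae_law_mem lam).mono fun x hx => ?_)
  simp only
  rw [zonal_ode hl n hx]; ring

/-- The form `∫ Z_n' Z_m' (1 - x²)` is computed by parts in both orders; the eigenvalues differ by
`(n - m) (n + m + 2 lam) ≠ 0`. -/
lemma integral_zonal_mul_zonal {n m : ℕ} (h : n ≠ m) :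
    ∫ x, (zonal lam n).eval x * (zonal lam m).eval x ∂(law lam) = 0 := by
  have h1 := integral_zonal_derivative hl m (u := fun x => (zonal lam n).eval x)
    (by fun_prop) (by fun_prop) (fun x _ => Polynomial.hasDerivAt _ x)
  have h2 := integral_zonal_derivative hl n (u := fun x => (zonal lam m).eval x)
    (by fun_prop) (by fun_prop) (fun x _ => Polynomial.hasDerivAt _ x)
  simp_rw [mul_comm ((zonal lam m).derivative.eval _)] at h2
  simp_rw [mul_comm ((zonal lam m).eval _)] at h2
  rw [h1] at h2
  set I := ∫ x, (zonal lam n).eval x * (zonal lam m).eval x ∂(law lam)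
  have h3 : ((n : ℝ) - m) * (n + m + 2 * lam) * I = 0 := by linear_combination -h2
  have h4 : (n : ℝ) - m ≠ 0 := sub_ne_zero.2 (by exact_mod_cast h)
  have h5 : (n : ℝ) + m + 2 * lam ≠ 0 := by
    have : 0 < (n : ℝ) + m := by
      have : 0 < n + m := by omega
      exact_mod_cast this
    positivity
  simpa [h4, h5] using h3

lemma polynomial_eq_zero_of_integral_sq (p : Polynomial ℝ)
    (h : ∫ x, p.eval x ^ 2 ∂(law lam) = 0) : p = 0 := by
  have : Fact (0 ≤ lam) := ⟨hl⟩
  by_contra hp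
  have hc : Continuous fun x => p.eval x ^ 2 := p.continuous.pow 2
  rw [integral_eq_zero_iff_of_nonneg (fun x => sq_nonneg _)
    (integrable_law_of_continuousOn hl hc.continuousOn)] at h
  have hfin : (law lam) {x | p.eval x = 0} = 0 := by
    refine Set.Finite.measure_zero ?_ _
    refine (p.roots.toFinset.finite_toSet).subset fun x hx => ?_
    simpa [hp] using hx
  have h2 : ∀ᵐ x ∂(law lam), False := by
    have h3 : ∀ᵐ x ∂(law lam), p.eval x ≠ 0 := by
      rw [ae_iff]; simpa using hfin
    filter_upwards [h, h3] with x h4 h5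
    simp at h4
    exact h5 h4
  rw [ae_iff] at h2
  simp at h2

lemma integral_zonal_sq_pos (n : ℕ) : 0 < ∫ x, (zonal lam n).eval x ^ 2 ∂(law lam) := by
  refine lt_of_le_of_ne (integral_nonneg fun x => sq_nonneg _) fun h => ?_
  have := polynomial_eq_zero_of_integral_sq hl _ h.symm
  have h1 := zonal_eval_one hl n
  rw [this] at h1
  simp at h1

end

/-- The orthonormal polynomials of the Gegenbauer law. -/
def orth (lam : ℝ) (n : ℕ) : Polynomial ℝ :=
  Polynomial.C (1 / √(∫ x, (zonal lam n).eval x ^ 2 ∂(law lam))) * zonal lam n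

section
variable {lam : ℝ} (hl : 0 ≤ lam)
include hl

lemma integral_orth_mul_orth (n m : ℕ) :
    ∫ x, (orth lam n).eval x * (orth lam m).eval x ∂(law lam) = if n = m then 1 else 0 := by
  simp only [orth, Polynomial.eval_mul, Polynomial.eval_C]
  set k := fun n => 1 / √(∫ x, (zonal lam n).eval x ^ 2 ∂(law lam)) with hk
  have h0 : ∀ x, k n * (zonal lam n).eval x * (k m * (zonal lam m).eval x)
      = k n * k m * ((zonal lam n).eval x * (zonal lam m).eval x) := fun x => by ring
  change ∫ x, k n * (zonal lam n).eval x * (k m * (zonal lam m).eval x) ∂(law lam) = _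
  simp_rw [h0]
  rw [integral_const_mul]
  split_ifs with h
  · subst h
    have := integral_zonal_sq_pos hl n
    simp_rw [← sq]
    rw [hk, div_pow, Real.sq_sqrt this.le]
    field_simp
  · rw [integral_zonal_mul_zonal hl h, mul_zero]

lemma integral_orth_derivative (n : ℕ) {u u' : ℝ → ℝ}
    (hu : ContinuousOn u (Icc (-1) 1)) (hu' : ContinuousOn u' (Icc (-1) 1))
    (hdu : ∀ x ∈ Ioo (-1 : ℝ) 1, HasDerivAt u (u' x) x) :
    ∫ x, u' x * (orth lam n).derivative.eval x * (1 - x ^ 2) ∂(law lam)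
      = n * (n + 2 * lam) * ∫ x, u x * (orth lam n).eval x ∂(law lam) := by
  have h := integral_zonal_derivative hl n hu hu' hdu
  simp only [orth, Polynomial.eval_mul, Polynomial.eval_C, Polynomial.derivative_mul,
    Polynomial.derivative_C, zero_mul, zero_add]
  set k := 1 / √(∫ x, (zonal lam n).eval x ^ 2 ∂(law lam))
  simp_rw [mul_left_comm _ k, mul_assoc k]
  rw [integral_const_mul, integral_const_mul, h]
  ring

lemma normPoly_eq (n : ℕ) {x : ℝ} (hx : x ∈ Ioo (-1 : ℝ) 1) :
    normPoly lam n x = (orth lam n).eval x := by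
  obtain ⟨k, hk, h⟩ := exists_poly_eq hl n
  have h1 : ∫ z, poly lam n z ^ 2 ∂(law lam)
      = k ^ 2 * ∫ z, (zonal lam n).eval z ^ 2 ∂(law lam) := by
    rw [← integral_const_mul]
    refine integral_congr_ae ((ae_law_mem lam).mono fun z hz => ?_)
    simp only [h z hz, mul_pow]
  have h2 := integral_zonal_sq_pos hl n
  rw [normPoly, h1, h x hx, orth, Real.sqrt_mul (sq_nonneg k), Real.sqrt_sq hk.le]
  simp only [Polynomial.eval_mul, Polynomial.eval_C]
  have := Real.sqrt_pos.2 h2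
  field_simp

lemma coeff_eq (φ : ℝ → ℝ) (n : ℕ) :
    coeff lam φ n = ∫ x, φ x * (orth lam n).eval x ∂(law lam) := by
  refine integral_congr_ae ((ae_law_mem lam).mono fun x hx => ?_)
  simp only [normPoly_eq hl n hx]

lemma orth_zero : orth lam 0 = 1 := by
  have : Fact (0 ≤ lam) := ⟨hl⟩
  simp [orth]

/-- The square of the distance to a linear combination of orthogonal functions. -/
lemma integral_sub_sum_sq {f : ℝ → ℝ} {g : ℕ → ℝ → ℝ} {w c : ℕ → ℝ}
    (hf : ContinuousOn f (Icc (-1) 1)) (hg : ∀ n, ContinuousOn (g n) (Icc (-1) 1))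
    (hgg : ∀ n m, ∫ x, g n x * g m x ∂(law lam) = if n = m then w n else 0)
    (hfg : ∀ n, ∫ x, f x * g n x ∂(law lam) = w n * c n) (d : ℕ → ℝ) (N : ℕ) :
    ∫ x, (f x - ∑ n ∈ Finset.range N, d n * g n x) ^ 2 ∂(law lam)
      = ∫ x, f x ^ 2 ∂(law lam) - ∑ n ∈ Finset.range N, w n * c n ^ 2
        + ∑ n ∈ Finset.range N, w n * (c n - d n) ^ 2 := by
  induction N with
  | zero => simp
  | succ N ih =>
    have hS : ContinuousOn (fun x => f x - ∑ n ∈ Finset.range N, d n * g n x) (Icc (-1) 1) :=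
      hf.sub (continuousOn_finsetSum _ fun n _ => (hg n).const_mul (d n))
    have hgN := hg N
    have i1 : ∀ n, Integrable (fun x => g n x * g N x) (law lam) := fun n =>
      integrable_law_of_continuousOn hl ((hg n).mul (hg N))
    have e1 : ∫ x, (f x - ∑ n ∈ Finset.range N, d n * g n x) * g N x ∂(law lam) = w N * c N := by
      have : ∀ x, (f x - ∑ n ∈ Finset.range N, d n * g n x) * g N x
          = f x * g N x - ∑ n ∈ Finset.range N, d n * (g n x * g N x) := fun x => by
        rw [sub_mul, Finset.sum_mul]; simp_rw [mul_assoc]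
      simp_rw [this]
      rw [integral_sub (integrable_law_of_continuousOn hl (f := fun x => f x * g N x) (hf.mul hgN))
        (integrable_finsetSum _ fun n _ => (i1 n).const_mul _),
        integral_finsetSum _ fun n _ => (i1 n).const_mul _, hfg, Finset.sum_eq_zero, sub_zero]
      intro n hn
      rw [integral_const_mul, hgg, if_neg (Finset.mem_range.1 hn).ne, mul_zero]
    have e2 : ∫ x, g N x * g N x ∂(law lam) = w N := by rw [hgg, if_pos rfl]
    have : ∀ x, (f x - ∑ n ∈ Finset.range (N + 1), d n * g n x) ^ 2
        = (f x - ∑ n ∈ Finset.range N, d n * g n x) ^ 2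
          - (2 * d N) * ((f x - ∑ n ∈ Finset.range N, d n * g n x) * g N x)
          + d N ^ 2 * (g N x * g N x) := fun x => by rw [Finset.sum_range_succ]; ring
    simp_rw [this]
    obtain ⟨A, hA⟩ : ∃ A : ℝ → ℝ, A = fun x => f x - ∑ n ∈ Finset.range N, d n * g n x := ⟨_, rfl⟩
    have hA' : ∀ x, f x - ∑ n ∈ Finset.range N, d n * g n x = A x := fun x => by rw [hA]
    rw [← hA] at hS
    simp only [hA'] at ih e1 ⊢
    have j1 : Integrable (fun x => A x ^ 2) (law lam) :=
      integrable_law_of_continuousOn hl (hS.pow 2)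
    have j2 : Integrable (fun x => 2 * d N * (A x * g N x)) (law lam) :=
      (integrable_law_of_continuousOn hl (hS.mul hgN)).const_mul _
    have j3 : Integrable (fun x => d N ^ 2 * (g N x * g N x)) (law lam) := (i1 N).const_mul _
    have j4 : Integrable (fun x => A x ^ 2 - 2 * d N * (A x * g N x)) (law lam) := j1.sub j2
    rw [integral_add j4 j3, integral_sub j1 j2, integral_const_mul, integral_const_mul, ih, e1, e2,
      Finset.sum_range_succ, Finset.sum_range_succ]
    ring

/-- Bessel's inequality for `u' √(1 - x²)` in the system `φ_n' √(1 - x²)`, which is orthogonal with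
squared norms `n (n + 2 lam)`. By parts, the coefficients of `u'` are those of `u`, so no second
derivative of `u` is needed. -/
lemma sum_coeff_sq_le_integral_deriv_sq {u u' : ℝ → ℝ}
    (hu : ContinuousOn u (Icc (-1) 1)) (hu' : ContinuousOn u' (Icc (-1) 1))
    (hdu : ∀ x ∈ Ioo (-1 : ℝ) 1, HasDerivAt u (u' x) x) (N : ℕ) :
    ∑ n ∈ Finset.range N, (n * (n + 2 * lam)) * coeff lam u n ^ 2
      ≤ ∫ x, u' x ^ 2 * (1 - x ^ 2) ∂(law lam) := by
  have hs : ∀ a b x : ℝ, x ∈ Ioo (-1 : ℝ) 1 →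
      a * √(1 - x ^ 2) * (b * √(1 - x ^ 2)) = a * b * (1 - x ^ 2) := fun a b x hx => by
    have : 0 ≤ 1 - x ^ 2 := by nlinarith [hx.1, hx.2]
    rw [mul_mul_mul_comm, Real.mul_self_sqrt this]
  have h := integral_sub_sum_sq hl (f := fun x => u' x * √(1 - x ^ 2))
    (g := fun n x => (orth lam n).derivative.eval x * √(1 - x ^ 2))
    (w := fun n => n * (n + 2 * lam)) (c := coeff lam u) (by fun_prop) (fun n => by fun_prop)
    (fun n m => by
      rw [integral_congr_ae ((ae_law_mem lam).mono fun x hx => hs _ _ x hx),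
        integral_orth_derivative hl m (u := fun x => (orth lam n).eval x) (by fun_prop)
          (by fun_prop) (fun x _ => Polynomial.hasDerivAt _ x), integral_orth_mul_orth hl]
      split_ifs with h
      · rw [h, mul_one]
      · rw [mul_zero])
    (fun n => by
      rw [integral_congr_ae ((ae_law_mem lam).mono fun x hx => hs _ _ x hx),
        integral_orth_derivative hl n hu hu' hdu, coeff_eq hl])
    (coeff lam u) N
  have h0 : 0 ≤ ∫ x, (u' x * √(1 - x ^ 2) - ∑ n ∈ Finset.range N,
      coeff lam u n * ((orth lam n).derivative.eval x * √(1 - x ^ 2))) ^ 2 ∂(law lam) :=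
    integral_nonneg fun x => sq_nonneg _
  rw [h] at h0
  have h1 : ∫ x, (u' x * √(1 - x ^ 2)) ^ 2 ∂(law lam)
      = ∫ x, u' x ^ 2 * (1 - x ^ 2) ∂(law lam) := by
    refine integral_congr_ae ((ae_law_mem lam).mono fun x hx => ?_)
    simp only [sq (u' x * _), hs _ _ x hx, sq (u' x)]
  simp only [sub_self, ne_eq, OfNat.ofNat_ne_zero, not_false_eq_true, zero_pow, mul_zero,
    Finset.sum_const_zero, add_zero] at h0
  linarith

lemma integral_sub_sum_orth_sq {f : ℝ → ℝ} (hf : ContinuousOn f (Icc (-1) 1)) (d : ℕ → ℝ) (N : ℕ) :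
    ∫ x, (f x - ∑ n ∈ Finset.range N, d n * (orth lam n).eval x) ^ 2 ∂(law lam)
      = ∫ x, f x ^ 2 ∂(law lam) - ∑ n ∈ Finset.range N, coeff lam f n ^ 2
        + ∑ n ∈ Finset.range N, (coeff lam f n - d n) ^ 2 := by
  have := integral_sub_sum_sq hl (g := fun n x => (orth lam n).eval x) (w := fun _ => 1)
    (c := coeff lam f) hf (fun n => by fun_prop) (integral_orth_mul_orth hl)
    (fun n => by rw [coeff_eq hl, one_mul]) d N
  simpa only [one_mul] using this

lemma exists_orth_expansion {n : ℕ} {p : Polynomial ℝ} (hp : p.natDegree ≤ n) :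
    ∃ d : ℕ → ℝ, ∀ x, p.eval x = ∑ m ∈ Finset.range (n + 1), d m * (orth lam m).eval x := by
  obtain ⟨b, hb⟩ := exists_zonal_expansion hl n p hp
  refine ⟨fun m => b m * √(∫ x, (zonal lam m).eval x ^ 2 ∂(law lam)), fun x => ?_⟩
  conv_lhs => rw [hb]
  rw [Polynomial.eval_finsetSum]
  refine Finset.sum_congr rfl fun m _ => ?_
  have := Real.sqrt_pos.2 (integral_zonal_sq_pos hl m)
  simp only [orth, Polynomial.eval_mul, Polynomial.eval_C]
  field_simp

/-- Completeness of the Gegenbauer polynomials. -/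
lemma tendsto_integral_sub_sum_orth_sq {f : ℝ → ℝ} (hf : ContinuousOn f (Icc (-1) 1)) :
    Tendsto (fun N => ∫ x, (f x - ∑ n ∈ Finset.range N, coeff lam f n * (orth lam n).eval x) ^ 2
      ∂(law lam)) atTop (𝓝 0) := by
  have : Fact (0 ≤ lam) := ⟨hl⟩
  rw [Metric.tendsto_atTop]
  intro ε hε
  -- Squared and integrated against a probability measure, this uniform error is at most `ε / 2`.
  obtain ⟨p, hp⟩ := exists_polynomial_near_of_continuousOn (-1) 1 f hf (√(ε / 2))
    (Real.sqrt_pos.2 (by linarith))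
  refine ⟨p.natDegree + 1, fun N hN => ?_⟩
  obtain ⟨M, rfl⟩ : ∃ M, N = M + 1 := ⟨N - 1, by omega⟩
  obtain ⟨d, hd⟩ := exists_orth_expansion hl (show p.natDegree ≤ M by omega)
  -- The two expansions differ by `∑ (c_n - d_n)² ≥ 0`: the Fourier partial sum is at least as close
  -- to `f` as `p` is.
  have h1 := integral_sub_sum_orth_sq hl hf (coeff lam f) (M + 1)
  have h2 := integral_sub_sum_orth_sq hl hf d (M + 1)
  simp_rw [← hd] at h2
  have h3 : ∫ x, (f x - p.eval x) ^ 2 ∂(law lam) ≤ ∫ x, ε / 2 ∂(law lam) := by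
    refine integral_mono_ae (integrable_law_of_continuousOn hl (by fun_prop))
      (integrable_const _) ((ae_law_mem lam).mono fun x hx => ?_)
    have := (hp x (Ioo_subset_Icc_self hx)).le
    rw [abs_sub_comm] at this
    have h4 := pow_le_pow_left₀ (abs_nonneg _) this 2
    rwa [sq_abs, Real.sq_sqrt (by linarith)] at h4
  have h4 : 0 ≤ ∑ n ∈ Finset.range (M + 1), (coeff lam f n - d n) ^ 2 :=
    Finset.sum_nonneg fun n _ => sq_nonneg _
  rw [Real.dist_eq, sub_zero, abs_of_nonneg (integral_nonneg fun x => sq_nonneg _), h1]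
  simp only [integral_const, probReal_univ, one_smul] at h3
  simp only [sub_self, ne_eq, OfNat.ofNat_ne_zero, not_false_eq_true, zero_pow,
    Finset.sum_const_zero, add_zero]
  linarith

lemma hasSum_coeff_sq {f : ℝ → ℝ} (hf : ContinuousOn f (Icc (-1) 1)) :
    HasSum (fun n => coeff lam f n ^ 2) (∫ x, f x ^ 2 ∂(law lam)) := by
  rw [hasSum_iff_tendsto_nat_of_nonneg fun n => sq_nonneg _]
  have h := tendsto_integral_sub_sum_orth_sq hl hf
  simp_rw [integral_sub_sum_orth_sq hl hf] at h
  have h2 := h.const_sub (∫ x, f x ^ 2 ∂(law lam))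
  simpa using h2

end

/-! ### The angular law. -/

/-- The normalizing constant of the angular law. -/
def angCst (lam : ℝ) : ℝ := (2 ^ (2 * lam - 1) * beta lam lam)⁻¹

lemma angCst_pos {lam : ℝ} (hl : 0 < lam) : 0 < angCst lam := by
  have := beta_pos hl hl
  unfold angCst; positivity

/-- The density of the angular law. -/
def angDens (lam z : ℝ) : ℝ := angCst lam * jac (lam - 1) (lam - 1) z

@[fun_prop]
lemma measurable_angDens (lam : ℝ) : Measurable (angDens lam) := by unfold angDens; fun_prop

lemma angDens_pos {lam : ℝ} (hl : 0 < lam) {x : ℝ} (hx : x ∈ Ioo (-1 : ℝ) 1) : 0 < angDens lam x :=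
  mul_pos (angCst_pos hl) (jac_pos _ _ hx)

/-- The angular law: the probability measure on `[-1, 1]` with density proportional to
`(1 - z ^ 2) ^ (lam - 1)`, and its limit, the Rademacher law, for `lam = 0`. -/
def ang (lam : ℝ) : Measure ℝ :=
  if lam = 0 then (2 : ENNReal)⁻¹ • Measure.dirac 1 + (2 : ENNReal)⁻¹ • Measure.dirac (-1)
  else (volume.restrict (Ioo (-1 : ℝ) 1)).withDensity fun z => ENNReal.ofReal (angDens lam z)

lemma lintegral_ang_zero (f : ℝ → ENNReal) :
    ∫⁻ z, f z ∂(ang 0) = 2⁻¹ * f 1 + 2⁻¹ * f (-1) := by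
  simp [ang, lintegral_add_measure, lintegral_smul_measure]

lemma lintegral_ang {lam : ℝ} (hl : 0 < lam) (f : ℝ → ENNReal) :
    ∫⁻ z, f z ∂(ang lam) = ∫⁻ z in Ioo (-1) 1, ENNReal.ofReal (angDens lam z) * f z := by
  rw [ang, if_neg hl.ne', lintegral_withDensity_eq_lintegral_mul_non_measurable _ (by fun_prop)
    (Eventually.of_forall fun _ => ENNReal.ofReal_lt_top)]
  rfl

lemma integral_ang_zero (f : ℝ → ℝ) : ∫ z, f z ∂(ang 0) = (f 1 + f (-1)) / 2 := by
  have h : ∀ a : ℝ, Integrable f ((2 : ENNReal)⁻¹ • Measure.dirac a) := fun a =>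
    (integrable_dirac (by simp)).smul_measure (by simp)
  rw [ang, if_pos rfl, integral_add_measure (h 1) (h (-1)), integral_smul_measure,
    integral_smul_measure, integral_dirac, integral_dirac]
  simp
  ring

lemma integral_ang {lam : ℝ} (hl : 0 < lam) (f : ℝ → ℝ) :
    ∫ z, f z ∂(ang lam) = ∫ z in Ioo (-1) 1, angDens lam z * f z := by
  rw [ang, if_neg hl.ne', integral_withDensity_eq_integral_toReal_smul (by fun_prop)
    (Eventually.of_forall fun _ => ENNReal.ofReal_lt_top)]
  refine setIntegral_congr_fun measurableSet_Ioo fun x hx => ?_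
  simp only [ENNReal.toReal_ofReal (angDens_pos hl hx).le, smul_eq_mul]

instance isProbabilityMeasure_ang (lam : ℝ) [Fact (0 ≤ lam)] : IsProbabilityMeasure (ang lam) := by
  have hl : 0 ≤ lam := Fact.out
  constructor
  rw [← lintegral_one]
  rcases hl.eq_or_lt with rfl | hl
  · rw [lintegral_ang_zero]; simp [ENNReal.inv_two_add_inv_two]
  rw [lintegral_ang hl]
  simp only [mul_one]
  have h1 : IntegrableOn (angDens lam) (Ioo (-1) 1) :=
    (integrableOn_jac (by linarith) (by linarith)).const_mul _
  rw [← ofReal_integral_eq_lintegral_ofReal h1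
    (ae_restrict_of_forall_mem measurableSet_Ioo fun x hx => (angDens_pos hl hx).le)]
  unfold angDens
  rw [integral_const_mul, integral_jac (by linarith) (by linarith),
    show lam - 1 + (lam - 1) + 1 = 2 * lam - 1 by ring, sub_add_cancel, angCst, inv_mul_cancel₀]
  · simp
  · have := beta_pos hl hl
    positivity

lemma ae_ang_mem_Ioo {lam : ℝ} (hl : 0 < lam) : ∀ᵐ z ∂(ang lam), z ∈ Ioo (-1 : ℝ) 1 := by
  rw [ang, if_neg hl.ne']
  have h : ∀ᵐ z ∂((volume.restrict (Ioo (-1 : ℝ) 1)).withDensity fun z =>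
      ENNReal.ofReal (angDens lam z)), z ∈ Ioo (-1 : ℝ) 1 :=
    (withDensity_absolutelyContinuous _ _).ae_le (ae_restrict_mem measurableSet_Ioo)
  exact h

lemma ae_ang_mem {lam : ℝ} (hl : 0 ≤ lam) : ∀ᵐ z ∂(ang lam), z ∈ Icc (-1 : ℝ) 1 := by
  rcases hl.eq_or_lt with rfl | hl
  · rw [ang, if_pos rfl, ae_add_measure_iff]
    constructor
    · refine Measure.ae_smul_measure ?_ _
      simp
    · refine Measure.ae_smul_measure ?_ _
      simp
  · exact (ae_ang_mem_Ioo hl).mono fun x hx => Ioo_subset_Icc_self hx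

lemma integral_ang_odd_pow {lam : ℝ} (hl : 0 ≤ lam) {j : ℕ} (hj : Odd j) :
    ∫ z, z ^ j ∂(ang lam) = 0 := by
  rcases hl.eq_or_lt with rfl | hl
  · rw [integral_ang_zero, hj.neg_pow]; simp
  · rw [integral_ang hl, ← integral_Ioc_eq_integral_Ioo,
      ← intervalIntegral.integral_of_le (by norm_num)]
    have h := intervalIntegral.integral_comp_neg (a := -1) (b := 1)
      (fun z => angDens lam z * z ^ j)
    have h2 : ∀ z : ℝ, angDens lam (-z) * (-z) ^ j = -(angDens lam z * z ^ j) := fun z => by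
      rw [hj.neg_pow, angDens, angDens, jac, jac, sub_neg_eq_add, ← sub_eq_add_neg,
        mul_comm ((1 + z) ^ _)]
      ring
    simp_rw [h2] at h
    rw [intervalIntegral.integral_neg, neg_neg] at h
    linarith

/-! ### The law on the disc and its invariance under reflections. -/

/-- The joint law of `(x, √(1 - x²) z)` for independent `x` of law `law lam` and `z` of law
`ang lam`; it is invariant under rotations. -/
def disc (lam : ℝ) : Measure (ℝ × ℝ) :=
  ((law lam).prod (ang lam)).map fun p => (p.1, √(1 - p.1 ^ 2) * p.2)

/-- The reflection of the plane exchanging `(1, 0)` and `(w, √(1 - w²))`. -/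
def refl (w : ℝ) (p : ℝ × ℝ) : ℝ × ℝ :=
  (p.1 * w + √(1 - w ^ 2) * p.2, √(1 - w ^ 2) * p.1 - w * p.2)

@[fun_prop]
lemma measurable_refl (w : ℝ) : Measurable (refl w) := by unfold refl; fun_prop

lemma refl_refl {w : ℝ} (hw : w ∈ Icc (-1 : ℝ) 1) (p : ℝ × ℝ) : refl w (refl w p) = p := by
  have h : √(1 - w ^ 2) ^ 2 = 1 - w ^ 2 := Real.sq_sqrt (by nlinarith [hw.1, hw.2])
  refine Prod.ext ?_ ?_ <;> simp only [refl]
  · linear_combination p.1 * h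
  · linear_combination p.2 * h

section
variable {lam : ℝ} (hl : 0 ≤ lam)
include hl

lemma lintegral_disc {F : ℝ × ℝ → ENNReal} (hF : Measurable F) :
    ∫⁻ p, F p ∂(disc lam) = ∫⁻ x, ∫⁻ z, F (x, √(1 - x ^ 2) * z) ∂(ang lam) ∂(law lam) := by
  have : Fact (0 ≤ lam) := ⟨hl⟩
  rw [disc, lintegral_map hF (by fun_prop), lintegral_prod _ (by fun_prop)]

omit hl in
/-- The density of `disc lam` with respect to the Lebesgue measure, for `0 < lam`. -/
def discDens (lam : ℝ) (p : ℝ × ℝ) : ENNReal :=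
  if p.1 ^ 2 + p.2 ^ 2 < 1 then
    ENNReal.ofReal (cst lam * angCst lam * (1 - p.1 ^ 2 - p.2 ^ 2) ^ (lam - 1)) else 0

omit hl in
@[fun_prop]
lemma measurable_discDens (lam : ℝ) : Measurable (discDens lam) := by
  unfold discDens
  exact Measurable.ite (measurableSet_lt (by fun_prop) (by fun_prop)) (by fun_prop) (by fun_prop)

omit hl in
lemma lintegral_comp_mul_left {s : ℝ} (hs : 0 < s) {f : ℝ → ENNReal} (hf : Measurable f) :
    ∫⁻ v, f v = ENNReal.ofReal s * ∫⁻ z, f (s * z) := by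
  have h := Real.map_volume_mul_left hs.ne'
  have h1 : ∫⁻ z, f (s * z) = ∫⁻ v, f v ∂(Measure.map (s * ·) volume) :=
    (lintegral_map hf (by fun_prop)).symm
  rw [h1, h, lintegral_smul_measure, smul_eq_mul, ← mul_assoc, ← ENNReal.ofReal_mul hs.le,
    abs_of_pos (inv_pos.2 hs), mul_inv_cancel₀ hs.ne', ENNReal.ofReal_one, one_mul]

omit hl in
-- Substituting `v = √(1 - x²) z`, the Jacobian takes half a power of `1 - x²` and the two weights
-- combine into a power of `1 - x² - v²`. The density is radial, whence the invariance.
lemma lintegral_disc_eq_volume (hl : 0 < lam) {F : ℝ × ℝ → ENNReal} (hF : Measurable F) :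
    ∫⁻ p, F p ∂(disc lam) = ∫⁻ p, discDens lam p * F p := by
  rw [lintegral_disc hl.le hF, lintegral_law, Measure.volume_eq_prod,
    lintegral_prod _ (by fun_prop), ← lintegral_indicator measurableSet_Ioo]
  refine lintegral_congr fun x => ?_
  by_cases hx : x ∈ Ioo (-1 : ℝ) 1
  · rw [indicator_of_mem hx, lintegral_ang hl, ← lintegral_const_mul _ (by fun_prop)]
    have h1 : 0 < 1 - x ^ 2 := by nlinarith [hx.1, hx.2]
    have hs : 0 < √(1 - x ^ 2) := Real.sqrt_pos.2 h1
    have hss : √(1 - x ^ 2) ^ 2 = 1 - x ^ 2 := Real.sq_sqrt h1.le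
    rw [lintegral_comp_mul_left hs (by fun_prop), ← lintegral_const_mul _ (by fun_prop),
      ← lintegral_indicator measurableSet_Ioo]
    refine lintegral_congr fun z => ?_
    by_cases hz : z ∈ Ioo (-1 : ℝ) 1
    · have h2 : 0 < 1 - z ^ 2 := by nlinarith [hz.1, hz.2]
      have h3 : x ^ 2 + (√(1 - x ^ 2) * z) ^ 2 < 1 := by rw [mul_pow, hss]; nlinarith
      rw [indicator_of_mem hz]
      simp only [discDens]
      rw [if_pos h3, ← mul_assoc, ← mul_assoc, ← ENNReal.ofReal_mul (dens_pos hl.le hx).le,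
        ← ENNReal.ofReal_mul hs.le]
      congr 2
      rw [mul_pow, hss, show 1 - x ^ 2 - (1 - x ^ 2) * z ^ 2 = (1 - x ^ 2) * (1 - z ^ 2) by ring,
        Real.mul_rpow h1.le h2.le, one_sub_sq_rpow _ (Ioo_subset_Icc_self hz), dens, angDens,
        ← one_sub_sq_rpow _ (Ioo_subset_Icc_self hx),
        show lam - 1 / 2 = (lam - 1) + 1 / 2 by ring, Real.rpow_add h1, Real.sqrt_eq_rpow]
      ring
    · have h3 : ¬ (x ^ 2 + (√(1 - x ^ 2) * z) ^ 2 < 1) := by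
        intro h
        rw [mul_pow, hss] at h
        have : z ^ 2 < 1 := by
          by_contra h4
          nlinarith
        exact hz (abs_lt.1 (by nlinarith [sq_abs z, abs_nonneg z]))
      rw [indicator_of_notMem hz]
      simp only [discDens]
      rw [if_neg h3]
      simp
  · rw [indicator_of_notMem hx]
    have : ∀ y, discDens lam (x, y) = 0 := fun y => by
      unfold discDens
      rw [if_neg]
      intro h
      simp only at h
      exact hx (abs_lt.1 (by nlinarith [sq_abs x, abs_nonneg x, sq_nonneg y]))
    simp [this]

omit hl in
lemma map_refl_volume {w : ℝ} (hw : w ∈ Icc (-1 : ℝ) 1) :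
    Measure.map (refl w) (volume : Measure (ℝ × ℝ)) = volume := by
  have h : √(1 - w ^ 2) ^ 2 = 1 - w ^ 2 := Real.sq_sqrt (by nlinarith [hw.1, hw.2])
  have hdet : LinearMap.det (Matrix.toLin (Module.Basis.finTwoProd ℝ) (Module.Basis.finTwoProd ℝ)
      !![w, √(1 - w ^ 2); √(1 - w ^ 2), -w]) = -1 := by
    rw [LinearMap.det_toLin, Matrix.det_fin_two_of]
    linear_combination -h
  have hr : refl w = Matrix.toLin (Module.Basis.finTwoProd ℝ) (Module.Basis.finTwoProd ℝ)
      !![w, √(1 - w ^ 2); √(1 - w ^ 2), -w] := by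
    funext p
    rw [Matrix.toLin_finTwoProd_apply]
    simp only [refl]
    refine Prod.ext ?_ ?_ <;> simp only <;> ring
  rw [hr, Measure.map_linearMap_addHaar_eq_smul_addHaar _ (by rw [hdet]; norm_num), hdet]
  simp

omit hl in
lemma discDens_refl {w : ℝ} (hw : w ∈ Icc (-1 : ℝ) 1) (p : ℝ × ℝ) :
    discDens lam (refl w p) = discDens lam p := by
  have h : √(1 - w ^ 2) ^ 2 = 1 - w ^ 2 := Real.sq_sqrt (by nlinarith [hw.1, hw.2])
  have h1 : (refl w p).1 ^ 2 + (refl w p).2 ^ 2 = p.1 ^ 2 + p.2 ^ 2 := by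
    simp only [refl]
    linear_combination (p.1 ^ 2 + p.2 ^ 2) * h
  simp only [discDens, h1, sub_sub]

omit hl in
lemma image_cos : Real.cos '' Ioo 0 Real.pi = Ioo (-1 : ℝ) 1 := by
  ext x
  constructor
  · rintro ⟨t, ht, rfl⟩
    have hs := Real.sin_pos_of_pos_of_lt_pi ht.1 ht.2
    have := Real.sin_sq_add_cos_sq t
    exact abs_lt.1 (by nlinarith [sq_abs (Real.cos t), abs_nonneg (Real.cos t)])
  · intro hx
    exact ⟨Real.arccos x, ⟨Real.arccos_pos.2 hx.2, by
      have := Real.arccos_lt_pi.2 hx.1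
      exact this⟩, Real.cos_arccos hx.1.le hx.2.le⟩

omit hl in
lemma lintegral_law_zero (f : ℝ → ENNReal) :
    ∫⁻ x, f x ∂(law 0)
      = ∫⁻ t in Ioo 0 Real.pi, ENNReal.ofReal (1 / Real.pi) * f (Real.cos t) := by
  rw [lintegral_law, ← image_cos, lintegral_image_eq_lintegral_abs_deriv_mul
    (f' := fun t => -Real.sin t) measurableSet_Ioo
    (fun t _ => (Real.hasDerivAt_cos t).hasDerivWithinAt)
    (Real.injOn_cos.mono Ioo_subset_Icc_self)]
  refine setLIntegral_congr_fun measurableSet_Ioo fun t ht => ?_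
  have hs := Real.sin_pos_of_pos_of_lt_pi ht.1 ht.2
  have hc : Real.cos t ∈ Ioo (-1 : ℝ) 1 := image_cos ▸ mem_image_of_mem _ ht
  rw [← mul_assoc, ← ENNReal.ofReal_mul (abs_nonneg _), abs_neg, abs_of_pos hs, dens,
    ← one_sub_sq_rpow _ (Ioo_subset_Icc_self hc)]
  congr 2
  have h : 1 - Real.cos t ^ 2 = Real.sin t ^ 2 := by linarith [Real.sin_sq_add_cos_sq t]
  rw [h, ← Real.rpow_natCast, ← Real.rpow_mul hs.le]
  norm_num [cst, Real.rpow_neg_one]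
  field_simp

omit hl in
-- For `lam = 0` the measure has no density: the arcsine law with a random sign is the uniform law
-- on the circle. The arc is written as a period starting at `-π`, to match `AddCircle`.
lemma lintegral_disc_zero {F : ℝ × ℝ → ENNReal} (hF : Measurable F) :
    ∫⁻ p, F p ∂(disc 0) = 2⁻¹ * ENNReal.ofReal (1 / Real.pi) *
      ∫⁻ t in Ioc (-Real.pi) (-Real.pi + 2 * Real.pi), F (Real.cos t, Real.sin t) := by
  set G := fun t : ℝ => F (Real.cos t, Real.sin t) with hG
  have hGm : Measurable G := by fun_prop
  have h1 : ∫⁻ p, F p ∂(disc 0) = ∫⁻ t in Ioo 0 Real.pi,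
      (2⁻¹ * ENNReal.ofReal (1 / Real.pi) * G t
        + 2⁻¹ * ENNReal.ofReal (1 / Real.pi) * G (-t)) := by
    rw [lintegral_disc le_rfl hF, lintegral_law_zero]
    refine setLIntegral_congr_fun measurableSet_Ioo fun t ht => ?_
    have hs := Real.sin_pos_of_pos_of_lt_pi ht.1 ht.2
    have h : √(1 - Real.cos t ^ 2) = Real.sin t := by
      rw [← Real.sin_sq, Real.sqrt_sq hs.le]
    simp only [lintegral_ang_zero, h, hG, Real.cos_neg, Real.sin_neg, mul_one, mul_neg]
    ring
  have h2 : ∫⁻ t in Ioo 0 Real.pi, G (-t) = ∫⁻ t in Ioo (-Real.pi) 0, G t := by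
    have hm := (Measure.measurePreserving_neg (volume : Measure ℝ)).setLIntegral_comp_preimage
      (measurableSet_Ioo (a := -Real.pi) (b := 0)) hGm
    rw [← hm]
    simp
  rw [h1, lintegral_add_left (by fun_prop), lintegral_const_mul _ (by fun_prop),
    lintegral_const_mul _ (by fun_prop), h2, ← mul_add]
  congr 1
  have h3 : Ioc (-Real.pi) (-Real.pi + 2 * Real.pi) = Ioc (-Real.pi) 0 ∪ Ioc 0 Real.pi := by
    rw [Ioc_union_Ioc_eq_Ioc (by linarith [Real.pi_pos]) Real.pi_pos.le]
    congr 1; ring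
  rw [h3, lintegral_union measurableSet_Ioc (by
    rw [Set.disjoint_left]; intro x hx hx'; exact absurd hx'.1 (not_lt.2 hx.2)),
    restrict_Ioo_eq_restrict_Ioc, restrict_Ioo_eq_restrict_Ioc, add_comm]

omit hl in
-- Haar measure on the circle is invariant under `t ↦ η - t`.
lemma lintegral_periodic_sub {G : ℝ → ENNReal} (hG : Function.Periodic G (2 * Real.pi)) (η : ℝ) :
    ∫⁻ t in Ioc (-Real.pi) (-Real.pi + 2 * Real.pi), G (η - t)
      = ∫⁻ t in Ioc (-Real.pi) (-Real.pi + 2 * Real.pi), G t := by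
  have : Fact (0 < 2 * Real.pi) := ⟨Real.two_pi_pos⟩
  have h1 := AddCircle.lintegral_preimage (2 * Real.pi) (-Real.pi) hG.lift
  have h2 := AddCircle.lintegral_preimage (2 * Real.pi) (-Real.pi)
    (fun b => hG.lift ((η : AddCircle (2 * Real.pi)) - b))
  rw [lintegral_sub_left_eq_self, ← h1] at h2
  exact h2

/-- The measure `disc lam` is invariant under reflections. -/
lemma map_refl_disc {w : ℝ} (hw : w ∈ Icc (-1 : ℝ) 1) :
    Measure.map (refl w) (disc lam) = disc lam := by
  refine Measure.ext_of_lintegral _ fun F hF => ?_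
  rw [lintegral_map hF (by fun_prop)]
  rcases hl.eq_or_lt with rfl | hl
  · rw [lintegral_disc_zero (F := fun p => F (refl w p)) (hF.comp (measurable_refl w)),
      lintegral_disc_zero hF]
    congr 1
    -- In the angular variable the reflection is `t ↦ arccos w - t`.
    rw [← lintegral_periodic_sub (G := fun t => F (Real.cos t, Real.sin t))
      (fun t => by simp only [Real.cos_add_two_pi, Real.sin_add_two_pi]) (Real.arccos w)]
    refine lintegral_congr fun t => ?_
    rw [Real.cos_sub, Real.sin_sub, Real.cos_arccos hw.1 hw.2, Real.sin_arccos]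
    simp only [refl]
    rw [mul_comm (Real.cos t) w, mul_comm w (Real.sin t)]
  · rw [lintegral_disc_eq_volume hl (F := fun p => F (refl w p)) (hF.comp (measurable_refl w)),
      lintegral_disc_eq_volume hl hF]
    conv_rhs => rw [← map_refl_volume hw]
    rw [lintegral_map (by fun_prop) (by fun_prop)]
    simp only [discDens_refl hw]

end

/-! ### Translates of polynomials and the product formula. -/

section
variable {lam : ℝ} (hl : 0 ≤ lam)
include hl

lemma isProbabilityMeasure_disc : IsProbabilityMeasure (disc lam) := by
  have : Fact (0 ≤ lam) := ⟨hl⟩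
  unfold disc
  exact Measure.isProbabilityMeasure_map (by fun_prop)

lemma map_fst_disc : Measure.map Prod.fst (disc lam) = law lam := by
  have : Fact (0 ≤ lam) := ⟨hl⟩
  rw [disc, Measure.map_map (by fun_prop) (by fun_prop)]
  change Measure.map Prod.fst _ = _
  rw [Measure.map_fst_prod]
  simp

lemma map_refl_fst_disc {w : ℝ} (hw : w ∈ Icc (-1 : ℝ) 1) :
    Measure.map (fun p => (refl w p).1) (disc lam) = law lam := by
  rw [← map_fst_disc hl, ← map_refl_disc hl hw, Measure.map_map (by fun_prop) (by fun_prop),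
    map_refl_disc hl hw]
  congr 1
  funext p
  simp only [Function.comp_apply, refl_refl hw]

lemma ae_disc_mem {w : ℝ} (hw : w ∈ Icc (-1 : ℝ) 1) :
    ∀ᵐ p ∂(disc lam), p.1 ∈ Icc (-1 : ℝ) 1 ∧ (refl w p).1 ∈ Icc (-1 : ℝ) 1 := by
  have h := (ae_law_mem lam).mono fun x hx => Ioo_subset_Icc_self hx
  have h1 := h
  have h2 := h
  rw [← map_fst_disc hl] at h1
  rw [← map_refl_fst_disc hl hw] at h2
  exact (ae_of_ae_map (by fun_prop) h1).and (ae_of_ae_map (by fun_prop) h2)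

lemma integrable_disc {w : ℝ} (hw : w ∈ Icc (-1 : ℝ) 1) {f g : ℝ → ℝ} (hf : Continuous f)
    (hg : Continuous g) : Integrable (fun p => f p.1 * g (refl w p).1) (disc lam) := by
  have := isProbabilityMeasure_disc hl
  obtain ⟨C, hC⟩ := (isCompact_Icc (a := (-1 : ℝ)) (b := 1)).exists_bound_of_continuousOn
    hf.continuousOn
  obtain ⟨C', hC'⟩ := (isCompact_Icc (a := (-1 : ℝ)) (b := 1)).exists_bound_of_continuousOn
    hg.continuousOn
  refine Integrable.of_bound (C := C * C')
    (Measurable.aestronglyMeasurable ((hf.measurable.comp (by fun_prop)).mul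
      (hg.measurable.comp (by fun_prop)))) ((ae_disc_mem hl hw).mono fun p hp => ?_)
  rw [norm_mul]
  exact mul_le_mul (hC _ hp.1) (hC' _ hp.2) (norm_nonneg _) ((norm_nonneg _).trans (hC _ hp.1))

lemma integral_disc_fst {w : ℝ} (hw : w ∈ Icc (-1 : ℝ) 1) {f : ℝ → ℝ} (hf : Continuous f) :
    ∫ p, f p.1 ∂(disc lam) = ∫ x, f x ∂(law lam) ∧
    ∫ p, f (refl w p).1 ∂(disc lam) = ∫ x, f x ∂(law lam) := by
  constructor
  · rw [← map_fst_disc hl, integral_map (by fun_prop) hf.aestronglyMeasurable]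
  · rw [← map_refl_fst_disc hl hw, integral_map (by fun_prop) hf.aestronglyMeasurable]

/-- The reflection preserves `disc lam` and is an involution, so it exchanges the two coordinates:
translation by `w` is a symmetric operator. -/
lemma integral_disc_symm {w : ℝ} (hw : w ∈ Icc (-1 : ℝ) 1) {f g : ℝ → ℝ} (hf : Continuous f)
    (hg : Continuous g) :
    ∫ p, f p.1 * g (refl w p).1 ∂(disc lam) = ∫ p, g p.1 * f (refl w p).1 ∂(disc lam) := by
  have hm : Measurable fun p => f p.1 * g (refl w p).1 :=
    (hf.measurable.comp (by fun_prop)).mul (hg.measurable.comp (by fun_prop))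
  conv_lhs => rw [← map_refl_disc hl hw]
  rw [integral_map (by fun_prop) hm.aestronglyMeasurable]
  simp only [refl_refl hw, mul_comm]

lemma integrable_ang {f : ℝ → ℝ} (hf : Continuous f) : Integrable f (ang lam) := by
  have : Fact (0 ≤ lam) := ⟨hl⟩
  obtain ⟨C, hC⟩ := (isCompact_Icc (a := (-1 : ℝ)) (b := 1)).exists_bound_of_continuousOn
    hf.continuousOn
  exact Integrable.of_bound hf.aestronglyMeasurable C ((ae_ang_mem hl).mono fun z hz => hC z hz)

lemma exists_translate_monomial {w : ℝ} (hw : w ∈ Icc (-1 : ℝ) 1) (k : ℕ) :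
    ∃ q : Polynomial ℝ, q.natDegree ≤ k ∧ ∀ x ∈ Icc (-1 : ℝ) 1,
      ∫ z, (x * w + √(1 - w ^ 2) * (√(1 - x ^ 2) * z)) ^ k ∂(ang lam) = q.eval x := by
  -- Binomial expansion: for even `k - m` the square roots become polynomials; for odd `k - m` the
  -- rounded exponent is harmless, as the moment of `z` vanishes.
  refine ⟨∑ m ∈ Finset.range (k + 1), Polynomial.C (w ^ m * (1 - w ^ 2) ^ ((k - m) / 2)
    * (∫ z, z ^ (k - m) ∂(ang lam)) * (k.choose m)) * (Polynomial.X ^ m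
      * (1 - Polynomial.X ^ 2) ^ ((k - m) / 2)), ?_, fun x hx => ?_⟩
  · refine Polynomial.natDegree_sum_le_of_forall_le _ _ fun m hm => ?_
    refine (Polynomial.natDegree_C_mul_le _ _).trans (Polynomial.natDegree_mul_le.trans ?_)
    have h1 : (1 - Polynomial.X ^ 2 : Polynomial ℝ).natDegree ≤ 2 := by compute_degree
    have h2 := Polynomial.natDegree_pow_le_of_le ((k - m) / 2) h1
    have h3 := Finset.mem_range.1 hm
    rw [Polynomial.natDegree_X_pow]
    omega
  · simp_rw [add_pow]
    rw [integral_finsetSum _ fun m _ => integrable_ang hl (by fun_prop), Polynomial.eval_finsetSum]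
    refine Finset.sum_congr rfl fun m _ => ?_
    have h1 : ∀ z : ℝ, (x * w) ^ m * (√(1 - w ^ 2) * (√(1 - x ^ 2) * z)) ^ (k - m) * (k.choose m)
        = ((x * w) ^ m * (√(1 - w ^ 2) * √(1 - x ^ 2)) ^ (k - m) * (k.choose m)) * z ^ (k - m) :=
      fun z => by rw [← mul_assoc (√_), mul_pow (_ * _) z]; ring
    simp_rw [h1]
    rw [integral_const_mul]
    simp only [Polynomial.eval_mul, Polynomial.eval_C, Polynomial.eval_pow, Polynomial.eval_X,
      Polynomial.eval_sub, Polynomial.eval_one]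
    rcases Nat.even_or_odd (k - m) with h | h
    · obtain ⟨i, hi⟩ := h
      have h2 : (√(1 - w ^ 2) * √(1 - x ^ 2)) ^ (k - m) = (1 - w ^ 2) ^ i * (1 - x ^ 2) ^ i := by
        rw [hi, ← two_mul, pow_mul, mul_pow, Real.sq_sqrt (by nlinarith [hw.1, hw.2]),
          Real.sq_sqrt (by nlinarith [hx.1, hx.2]), mul_pow]
      rw [h2, show (k - m) / 2 = i by omega]
      ring
    · rw [integral_ang_odd_pow hl h]
      ring

lemma exists_translate {w : ℝ} (hw : w ∈ Icc (-1 : ℝ) 1) (p : Polynomial ℝ) :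
    ∃ q : Polynomial ℝ, q.natDegree ≤ p.natDegree ∧ ∀ x ∈ Icc (-1 : ℝ) 1,
      ∫ z, p.eval (x * w + √(1 - w ^ 2) * (√(1 - x ^ 2) * z)) ∂(ang lam) = q.eval x := by
  choose q hq hq' using fun k => exists_translate_monomial hl hw k
  refine ⟨∑ k ∈ Finset.range (p.natDegree + 1), Polynomial.C (p.coeff k) * q k, ?_, fun x hx => ?_⟩
  · refine Polynomial.natDegree_sum_le_of_forall_le _ _ fun k hk => ?_
    have h3 := Finset.mem_range.1 hk
    exact (Polynomial.natDegree_C_mul_le _ _).trans ((hq k).trans (by omega))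
  · simp_rw [Polynomial.eval_eq_sum_range]
    rw [integral_finsetSum _ fun m _ => integrable_ang hl (by fun_prop)]
    simp_rw [integral_const_mul, hq' _ x hx]
    rw [← Polynomial.eval_eq_sum_range, Polynomial.eval_finsetSum]
    simp

/-- The translate is the conditional expectation of `p` of the reflected coordinate given the first
one. -/
lemma integral_disc_polynomial {w : ℝ} (hw : w ∈ Icc (-1 : ℝ) 1) {f : ℝ → ℝ} (hf : Continuous f)
    {p q : Polynomial ℝ} (hq : ∀ x ∈ Icc (-1 : ℝ) 1,
      ∫ z, p.eval (x * w + √(1 - w ^ 2) * (√(1 - x ^ 2) * z)) ∂(ang lam) = q.eval x) :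
    ∫ r, f r.1 * p.eval (refl w r).1 ∂(disc lam) = ∫ x, f x * q.eval x ∂(law lam) := by
  have : Fact (0 ≤ lam) := ⟨hl⟩
  have hi := integrable_disc hl hw hf p.continuous
  have hm : Measurable fun r => f r.1 * p.eval (refl w r).1 :=
    (hf.measurable.comp (by fun_prop)).mul (p.continuous.measurable.comp (by fun_prop))
  unfold disc at hi ⊢
  rw [integral_map (by fun_prop) hm.aestronglyMeasurable]
  rw [integrable_map_measure hm.aestronglyMeasurable (by fun_prop)] at hi
  refine (integral_prod _ hi).trans ?_
  refine integral_congr_ae ((ae_law_mem lam).mono fun x hx => ?_)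
  simp only [refl, Function.comp_apply]
  rw [integral_const_mul, hq x (Ioo_subset_Icc_self hx)]

lemma integral_mul_zonal_of_lt {n : ℕ} {p : Polynomial ℝ} (hp : p.natDegree < n) :
    ∫ x, p.eval x * (zonal lam n).eval x ∂(law lam) = 0 := by
  obtain ⟨b, hb⟩ := exists_zonal_expansion hl _ p le_rfl
  have : ∀ x, p.eval x * (zonal lam n).eval x = ∑ m ∈ Finset.range (p.natDegree + 1),
      b m * ((zonal lam m).eval x * (zonal lam n).eval x) := fun x => by
    conv_lhs => rw [hb]
    rw [Polynomial.eval_finsetSum, Finset.sum_mul]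
    simp [mul_assoc]
  simp_rw [this]
  rw [integral_finsetSum _ fun m _ => integrable_law_of_continuousOn hl (by fun_prop)]
  refine Finset.sum_eq_zero fun m hm => ?_
  have := Finset.mem_range.1 hm
  rw [integral_const_mul, integral_zonal_mul_zonal hl (by omega), mul_zero]

/-- The product formula of Gegenbauer. -/
lemma integral_ang_zonal {w : ℝ} (hw : w ∈ Icc (-1 : ℝ) 1) (n : ℕ) {x : ℝ}
    (hx : x ∈ Icc (-1 : ℝ) 1) :
    ∫ z, (zonal lam n).eval (x * w + √(1 - w ^ 2) * (√(1 - x ^ 2) * z)) ∂(ang lam)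
      = (zonal lam n).eval w * (zonal lam n).eval x := by
  have : Fact (0 ≤ lam) := ⟨hl⟩
  have hdeg := fun n => (zonal_natDegree_le_and_coeff_pos hl n).1
  obtain ⟨q, hq, hq'⟩ := exists_translate hl hw (zonal lam n)
  obtain ⟨b, hb⟩ := exists_zonal_expansion hl n q (hq.trans (hdeg n))
  -- By symmetry, pairing the translate of `Z_n` with `Z_m` equals pairing `Z_n` with the translate
  -- of `Z_m`, which has degree below `n`.
  have hb0 : ∀ m < n, b m = 0 := by
    intro m hm
    obtain ⟨r, hr, hr'⟩ := exists_translate hl hw (zonal lam m)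
    have h1 := integral_disc_polynomial hl hw (zonal lam m).continuous hq'
    rw [integral_disc_symm hl hw (zonal lam m).continuous (zonal lam n).continuous,
      integral_disc_polynomial hl hw (zonal lam n).continuous hr'] at h1
    simp_rw [mul_comm ((zonal lam n).eval _)] at h1
    rw [integral_mul_zonal_of_lt hl ((hr.trans (hdeg m)).trans_lt hm)] at h1
    have h2 : ∀ x, (zonal lam m).eval x * q.eval x = ∑ j ∈ Finset.range (n + 1),
        b j * ((zonal lam m).eval x * (zonal lam j).eval x) := fun x => by
      conv_lhs => rw [hb]
      rw [Polynomial.eval_finsetSum, Finset.mul_sum]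
      simp [mul_left_comm]
    simp_rw [h2] at h1
    rw [integral_finsetSum _ fun m _ => integrable_law_of_continuousOn hl (by fun_prop),
      Finset.sum_eq_single m (fun j _ hj => by
        rw [integral_const_mul, integral_zonal_mul_zonal hl hj.symm, mul_zero])
      (fun h => absurd (Finset.mem_range.2 (by omega)) h), integral_const_mul] at h1
    simp_rw [← sq] at h1
    exact ((mul_eq_zero.1 h1.symm).resolve_right (integral_zonal_sq_pos hl m).ne')
  have hqn : ∀ x, q.eval x = b n * (zonal lam n).eval x := fun x => by
    rw [hb, Polynomial.eval_finsetSum, Finset.sum_range_succ, Finset.sum_eq_zero]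
    · simp
    · intro m hm
      rw [hb0 m (Finset.mem_range.1 hm)]; simp
  -- At `x = 1` the average no longer depends on `z`, and this fixes the eigenvalue as `Z_n(w)`.
  have h1 := hq' 1 (by simp)
  rw [hqn, zonal_eval_one hl] at h1
  simp at h1
  rw [hq' x hx, hqn, h1]

lemma integral_disc_orth {w : ℝ} (hw : w ∈ Icc (-1 : ℝ) 1) (n : ℕ) {f : ℝ → ℝ}
    (hf : Continuous f) :
    ∫ p, f p.1 * (orth lam n).eval (refl w p).1 ∂(disc lam)
      = (zonal lam n).eval w * coeff lam f n := by
  rw [integral_disc_polynomial hl hw hf (q := Polynomial.C ((zonal lam n).eval w) * orth lam n),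
    coeff_eq hl, ← integral_const_mul]
  · refine integral_congr_ae (Eventually.of_forall fun x => ?_)
    simp only [Polynomial.eval_mul, Polynomial.eval_C]; ring
  · intro x hx
    simp only [orth, Polynomial.eval_mul, Polynomial.eval_C]
    rw [integral_const_mul, integral_ang_zonal hl hw n hx]
    ring

/-! ### Spectral decomposition of translation energies. -/

omit hl in
/-- The energy `∬ (f(x) - f(y))²` where `x` and `y` are the coordinates of a random point of the
disc in two directions with inner product `w`. -/
def translateEnergy (lam w : ℝ) (f : ℝ → ℝ) : ℝ := ∫ p, (f p.1 - f (refl w p).1) ^ 2 ∂(disc lam)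

/-- This `L²` bound makes the energies of the remainders of the expansion tend to zero. -/
lemma translateEnergy_le {w : ℝ} (hw : w ∈ Icc (-1 : ℝ) 1) {f : ℝ → ℝ} (hf : Continuous f) :
    translateEnergy lam w f ≤ 4 * ∫ x, f x ^ 2 ∂(law lam) := by
  have h := integral_disc_fst hl hw (hf.pow 2)
  have i1 := integrable_disc hl hw (hf.pow 2) continuous_one
  have i2 := integrable_disc hl hw continuous_one (hf.pow 2)
  simp only [Pi.one_apply, mul_one, one_mul, Pi.pow_apply] at i1 i2 h
  have h2 : translateEnergy lam w f
      ≤ ∫ p, (2 * f p.1 ^ 2 + 2 * f (refl w p).1 ^ 2) ∂(disc lam) := by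
    refine integral_mono_of_nonneg (Eventually.of_forall fun p => sq_nonneg _)
      ((i1.const_mul 2).add (i2.const_mul 2)) (Eventually.of_forall fun p => ?_)
    simp only
    nlinarith [sq_nonneg (f p.1 + f (refl w p).1)]
  rw [integral_add (i1.const_mul 2) (i2.const_mul 2), integral_const_mul, integral_const_mul, h.1,
    h.2] at h2
  linarith

lemma integral_disc_polar {w : ℝ} (hw : w ∈ Icc (-1 : ℝ) 1) {f g : ℝ → ℝ} (hf : Continuous f)
    (hg : Continuous g) :
    Integrable (fun p => (f p.1 - f (refl w p).1) * (g p.1 - g (refl w p).1)) (disc lam) ∧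
    ∫ p, (f p.1 - f (refl w p).1) * (g p.1 - g (refl w p).1) ∂(disc lam)
      = 2 * ∫ x, f x * g x ∂(law lam) - 2 * ∫ p, f p.1 * g (refl w p).1 ∂(disc lam) := by
  have hfg : Continuous fun x => f x * g x := hf.mul hg
  have a1 := integrable_disc hl hw hfg continuous_one
  have a2 := integrable_disc hl hw continuous_one hfg
  simp only [Pi.one_apply, mul_one, one_mul] at a1 a2
  have a3 := integrable_disc hl hw hf hg
  have a4 := integrable_disc hl hw hg hf
  have h1 := integral_disc_fst hl hw hfg
  have a5 : Integrable (fun p => f p.1 * g p.1 + f (refl w p).1 * g (refl w p).1) (disc lam) :=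
    a1.add a2
  have a6 : Integrable (fun p => f p.1 * g (refl w p).1 + g p.1 * f (refl w p).1) (disc lam) :=
    a3.add a4
  have e : ∀ p : ℝ × ℝ, (f p.1 - f (refl w p).1) * (g p.1 - g (refl w p).1)
      = (f p.1 * g p.1 + f (refl w p).1 * g (refl w p).1)
        - (f p.1 * g (refl w p).1 + g p.1 * f (refl w p).1) := fun p => by ring
  simp_rw [e]
  refine ⟨a5.sub a6, ?_⟩
  rw [integral_sub a5 a6, integral_add a1 a2, integral_add a3 a4, h1.1, h1.2,
    ← integral_disc_symm hl hw hf hg]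
  ring

lemma integrable_translateEnergy {w : ℝ} (hw : w ∈ Icc (-1 : ℝ) 1) {f : ℝ → ℝ}
    (hf : Continuous f) : Integrable (fun p => (f p.1 - f (refl w p).1) ^ 2) (disc lam) := by
  simp_rw [sq]
  exact (integral_disc_polar hl hw hf hf).1

lemma translateEnergy_sub {w : ℝ} (hw : w ∈ Icc (-1 : ℝ) 1) {f : ℝ → ℝ} (hf : Continuous f)
    (n : ℕ) (c : ℝ) :
    translateEnergy lam w (fun x => f x - c * (orth lam n).eval x)
      = translateEnergy lam w f - 4 * c * (1 - (zonal lam n).eval w) * coeff lam f n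
        + 2 * c ^ 2 * (1 - (zonal lam n).eval w) := by
  have he : Continuous fun x => (orth lam n).eval x := (orth lam n).continuous
  obtain ⟨b1, c1⟩ := integral_disc_polar hl hw hf he
  obtain ⟨b2, c2⟩ := integral_disc_polar hl hw he he
  have b0 := integrable_translateEnergy hl hw hf
  rw [integral_disc_orth hl hw n hf, ← coeff_eq hl] at c1
  rw [integral_disc_orth hl hw n he, coeff_eq hl (fun x => (orth lam n).eval x),
    integral_orth_mul_orth hl, if_pos rfl] at c2
  have e4 : ∀ p : ℝ × ℝ, (f p.1 - c * (orth lam n).eval p.1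
        - (f (refl w p).1 - c * (orth lam n).eval (refl w p).1)) ^ 2
      = (f p.1 - f (refl w p).1) ^ 2 - (2 * c) * ((f p.1 - f (refl w p).1)
        * ((orth lam n).eval p.1 - (orth lam n).eval (refl w p).1))
        + c ^ 2 * (((orth lam n).eval p.1 - (orth lam n).eval (refl w p).1)
          * ((orth lam n).eval p.1 - (orth lam n).eval (refl w p).1)) := fun p => by ring
  unfold translateEnergy
  simp_rw [e4]
  have b3 : Integrable (fun p => (f p.1 - f (refl w p).1) ^ 2
      - (2 * c) * ((f p.1 - f (refl w p).1)
        * ((orth lam n).eval p.1 - (orth lam n).eval (refl w p).1))) (disc lam) :=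
    b0.sub (b1.const_mul _)
  rw [integral_add b3 (b2.const_mul _), integral_sub b0 (b1.const_mul _), integral_const_mul,
    integral_const_mul, c1, c2]
  ring

lemma coeff_sub_sum {f : ℝ → ℝ} (hf : Continuous f) (N : ℕ) :
    coeff lam (fun x => f x - ∑ n ∈ Finset.range N, coeff lam f n * (orth lam n).eval x) N
      = coeff lam f N := by
  rw [coeff_eq hl, coeff_eq hl f N]
  simp_rw [sub_mul, Finset.sum_mul, mul_assoc]
  rw [integral_sub (integrable_law_of_continuousOn hl (by fun_prop))
    (integrable_law_of_continuousOn hl (by fun_prop)), integral_finsetSum _ fun m _ =>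
    integrable_law_of_continuousOn hl (by fun_prop), Finset.sum_eq_zero, sub_zero]
  intro m hm
  rw [integral_const_mul, integral_orth_mul_orth hl, if_neg (Finset.mem_range.1 hm).ne, mul_zero]

lemma translateEnergy_sub_sum {w : ℝ} (hw : w ∈ Icc (-1 : ℝ) 1) {f : ℝ → ℝ} (hf : Continuous f)
    (N : ℕ) :
    translateEnergy lam w
        (fun x => f x - ∑ n ∈ Finset.range N, coeff lam f n * (orth lam n).eval x)
      = translateEnergy lam w f
        - ∑ n ∈ Finset.range N, 2 * coeff lam f n ^ 2 * (1 - (zonal lam n).eval w) := by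
  induction N with
  | zero => simp
  | succ N ih =>
    have h := translateEnergy_sub hl hw
      (f := fun x => f x - ∑ n ∈ Finset.range N, coeff lam f n * (orth lam n).eval x)
      (by fun_prop) N (coeff lam f N)
    rw [ih, coeff_sub_sum hl hf] at h
    simp_rw [Finset.sum_range_succ, ← sub_sub]
    rw [h]
    ring

/-- The energy of `φ_n` itself is `2 (1 - Z_n(w))`, and an energy is nonnegative. -/
lemma zonal_le_one {w : ℝ} (hw : w ∈ Icc (-1 : ℝ) 1) (n : ℕ) : (zonal lam n).eval w ≤ 1 := by
  have h := translateEnergy_sub hl hw (f := fun _ => 0) continuous_const n 1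
  have h0 : 0 ≤ translateEnergy lam w (fun x => 0 - 1 * (orth lam n).eval x) :=
    integral_nonneg fun p => sq_nonneg _
  rw [h] at h0
  simp [translateEnergy, coeff] at h0
  exact h0

lemma hasSum_translateEnergy {w : ℝ} (hw : w ∈ Icc (-1 : ℝ) 1) {f : ℝ → ℝ} (hf : Continuous f) :
    HasSum (fun n => 2 * coeff lam f n ^ 2 * (1 - (zonal lam n).eval w))
      (translateEnergy lam w f) := by
  rw [hasSum_iff_tendsto_nat_of_nonneg fun n =>
    mul_nonneg (by positivity) (sub_nonneg.2 (zonal_le_one hl hw n))]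
  have h := (tendsto_integral_sub_sum_orth_sq hl hf.continuousOn).const_mul 4
  rw [mul_zero] at h
  have h1 : Tendsto (fun N => translateEnergy lam w
      (fun x => f x - ∑ n ∈ Finset.range N, coeff lam f n * (orth lam n).eval x)) atTop (𝓝 0) :=
    squeeze_zero (fun N => integral_nonneg fun p => sq_nonneg _)
      (fun N => translateEnergy_le hl hw (by fun_prop)) h
  simp_rw [translateEnergy_sub_sum hl hw hf] at h1
  simpa using h1.const_sub (translateEnergy lam w f)

/-- In extended nonnegative form, the sum can later be integrated in `w` against the singular jump
kernel with no convergence to check. -/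
lemma lintegral_translateEnergy {w : ℝ} (hw : w ∈ Icc (-1 : ℝ) 1) {f : ℝ → ℝ} (hf : Continuous f) :
    ∫⁻ p, ENNReal.ofReal ((f p.1 - f (refl w p).1) ^ 2) ∂(disc lam)
      = ∑' n, ENNReal.ofReal (2 * coeff lam f n ^ 2 * (1 - (zonal lam n).eval w)) := by
  have h := hasSum_translateEnergy hl hw hf
  rw [← ENNReal.ofReal_tsum_of_nonneg (fun n =>
    mul_nonneg (by positivity) (sub_nonneg.2 (zonal_le_one hl hw n))) h.summable, h.tsum_eq,
    translateEnergy, ofReal_integral_eq_lintegral_ofReal _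
      (Eventually.of_forall fun p => sq_nonneg _)]
  exact integrable_translateEnergy hl hw hf

end

/-! ### The eigenvalues of the jump kernel. -/

section
variable {lam : ℝ} (hl : 0 ≤ lam)
include hl

lemma cst_mul_integral_jac :
    2 ^ (-lam) * cst lam * ∫ x in Ioo (-1) 1, jac (-1 / 2) (lam - 1 / 2) x = 1 := by
  have h1 := Real.Gamma_pos_of_pos (show 0 < lam + 1 by linarith)
  have h2 := Real.Gamma_pos_of_pos (show 0 < 2 * lam + 1 by linarith)
  have h3 := Real.Gamma_mul_Gamma_add_half (lam + 1 / 2)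
  rw [show lam + 1 / 2 + 1 / 2 = lam + 1 by ring, show 2 * (lam + 1 / 2) = 2 * lam + 1 by ring,
    show 1 - (2 * lam + 1) = - (2 * lam) by ring, Real.rpow_neg (by norm_num)] at h3
  have h4 : Real.Gamma (lam + 1 / 2)
      = Real.Gamma (2 * lam + 1) * (2 ^ (2 * lam))⁻¹ * √Real.pi / Real.Gamma (lam + 1) := by
    rw [← h3]; field_simp
  have h5 := Real.sq_sqrt Real.pi_pos.le
  have h6 : (0 : ℝ) < 2 ^ (2 * lam) := by positivity
  have h7 : (0 : ℝ) < 2 ^ lam := by positivity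
  have := Real.pi_pos
  rw [integral_jac (by norm_num) (by linarith), show -1 / 2 + (lam - 1 / 2) + 1 = lam by ring,
    show lam - 1 / 2 + 1 = lam + 1 / 2 by ring, show (-1 / 2 + 1 : ℝ) = 1 / 2 by norm_num, beta,
    show lam + 1 / 2 + 1 / 2 = lam + 1 by ring, Real.Gamma_one_half_eq, h4, cst,
    Real.rpow_neg (by norm_num)]
  field_simp
  exact h5

omit hl in
lemma integrableOn_jac_polynomial (hl : 0 ≤ lam) (p : Polynomial ℝ) :
    IntegrableOn (fun x => jac (-1 / 2) (lam - 1 / 2) x * p.eval x) (Ioo (-1) 1) :=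
  integrableOn_jac_mul (by norm_num) (by linarith) (by fun_prop)

omit hl in
/-- The moment `∫ (1 - x)^(-1/2) (1 + x)^(lam - 1/2) p(x) dx`. -/
def moment (lam : ℝ) (p : Polynomial ℝ) : ℝ :=
  ∫ x in Ioo (-1) 1, jac (-1 / 2) (lam - 1 / 2) x * p.eval x

omit hl in
lemma moment_add (hl : 0 ≤ lam) (p q : Polynomial ℝ) :
    moment lam (p + q) = moment lam p + moment lam q := by
  simp only [moment, Polynomial.eval_add, mul_add]
  exact integral_add (integrableOn_jac_polynomial hl p) (integrableOn_jac_polynomial hl q)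

omit hl in
lemma moment_C_mul (a : ℝ) (p : Polynomial ℝ) :
    moment lam (Polynomial.C a * p) = a * moment lam p := by
  simp only [moment, Polynomial.eval_mul, Polynomial.eval_C, mul_left_comm _ a]
  exact integral_const_mul _ _

/-- The integral of the derivative of `(1 - x)^(1/2) (1 + x)^(lam + 1/2) Z_n` vanishes. -/
lemma moment_ladder (n : ℕ) :
    lam * moment lam (zonal lam n) - (lam + 1) * moment lam (Polynomial.X * zonal lam n)
      + moment lam ((1 - Polynomial.X ^ 2) * (zonal lam n).derivative) = 0 := by
  have h := integral_jac_deriv (α := -1 / 2) (β := lam - 1 / 2) (by norm_num) (by linarith)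
    (g := fun x => (zonal lam n).eval x) (g' := fun x => (zonal lam n).derivative.eval x)
    (by fun_prop) (by fun_prop) (fun x _ => Polynomial.hasDerivAt _ x)
  have h2 := moment_C_mul (lam := lam) lam (zonal lam n)
  have h3 := moment_C_mul (lam := lam) (-(lam + 1)) (Polynomial.X * zonal lam n)
  have h4 : moment lam (Polynomial.C lam * zonal lam n
      + Polynomial.C (-(lam + 1)) * (Polynomial.X * zonal lam n)
      + (1 - Polynomial.X ^ 2) * (zonal lam n).derivative) = 0 := by
    rw [← h, moment]
    refine integral_congr_ae (Eventually.of_forall fun x => ?_)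
    simp only [Polynomial.eval_add, Polynomial.eval_mul, Polynomial.eval_C, Polynomial.eval_X,
      Polynomial.eval_sub, Polynomial.eval_one, Polynomial.eval_pow]
    ring
  rw [moment_add hl, moment_add hl, h2, h3] at h4
  linarith

/-- The moment of `X Z_(n+1)` is eliminated between `moment_ladder` and the three-term recurrence.
-/
lemma moment_zonal_recurrence (n : ℕ) :
    (n + 1 + 2 * lam) * (n + 2 + lam) * moment lam (zonal lam (n + 2))
      = 2 * lam * (n + 1 + lam) * moment lam (zonal lam (n + 1))
        + (n + 1) * (n + lam) * moment lam (zonal lam n) := by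
  have h1 := moment_ladder hl (n + 1)
  have h2 : (1 - Polynomial.X ^ 2) * (zonal lam (n + 1)).derivative
      = Polynomial.C ((n : ℝ) + 1) * zonal lam n
        + Polynomial.C (-((n : ℝ) + 1)) * (Polynomial.X * zonal lam (n + 1)) := by
    refine Polynomial.funext fun x => ?_
    have := (zonal_ladder hl n x).1
    simp only [Polynomial.eval_add, Polynomial.eval_mul, Polynomial.eval_C, Polynomial.eval_X,
      Polynomial.eval_sub, Polynomial.eval_one, Polynomial.eval_pow]
    rw [this]; ring
  have h3 : Polynomial.C ((n : ℝ) + 1 + 2 * lam) * zonal lam (n + 2)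
      = Polynomial.C (2 * (n + 1 + lam)) * (Polynomial.X * zonal lam (n + 1))
        + Polynomial.C (-((n : ℝ) + 1)) * zonal lam n := by
    refine Polynomial.funext fun x => ?_
    have := zonal_three_term hl n x
    simp only [Polynomial.eval_add, Polynomial.eval_mul, Polynomial.eval_C, Polynomial.eval_X]
    rw [this]; ring
  have h4 := congrArg (moment lam) h3
  rw [moment_C_mul, moment_add hl, moment_C_mul, moment_C_mul] at h4
  rw [h2, moment_add hl, moment_C_mul, moment_C_mul] at h1
  linear_combination (n + 2 + lam) * h4 - 2 * (n + 1 + lam) * h1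

/-- Stated without division, as `n + lam` vanishes for `n = 0` and `lam = 0`. -/
lemma moment_zonal (n : ℕ) :
    (n + lam) * (2 ^ (-lam) * cst lam * moment lam (zonal lam n)) = lam := by
  have h0 : 2 ^ (-lam) * cst lam * moment lam (zonal lam 0) = 1 := by
    simpa [moment] using cst_mul_integral_jac hl
  induction n using Nat.twoStepInduction with
  | zero => rw [h0]; simp
  | one =>
    have h1 := moment_ladder hl 0
    simp only [zonal_zero, mul_one, Polynomial.derivative_one, mul_zero] at h1
    have h2 : moment lam 0 = 0 := by simp [moment]
    rw [h2] at h1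
    simp only [zonal_zero] at h0
    simp only [zonal_one]
    push_cast
    linear_combination lam * h0 - 2 ^ (-lam) * cst lam * h1
  | more n h1 h2 =>
    have h3 := moment_zonal_recurrence hl n
    have h4 : (n : ℝ) + 1 + 2 * lam ≠ 0 := by positivity
    push_cast at h2 ⊢
    apply mul_left_cancel₀ h4
    linear_combination 2 ^ (-lam) * cst lam * h3 + 2 * lam * h2 + (n + 1) * h1

lemma exists_one_sub_zonal (n : ℕ) :
    ∃ q : Polynomial ℝ, 1 - zonal lam n = (1 - Polynomial.X) * q := by
  have h : Polynomial.X - Polynomial.C 1 ∣ 1 - zonal lam n := by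
    rw [Polynomial.dvd_iff_isRoot]
    simp [zonal_eval_one hl n]
  obtain ⟨q, hq⟩ := h
  refine ⟨-q, hq.trans ?_⟩
  simp only [Polynomial.C_1]
  ring

lemma moment_quotient {q : ℕ → Polynomial ℝ}
    (hq : ∀ n, 1 - zonal lam n = (1 - Polynomial.X) * q n) (n : ℕ) :
    2 ^ (-lam) * cst lam * moment lam (q n) = n := by
  have hX : (1 - Polynomial.X : Polynomial ℝ) ≠ 0 := by
    intro h
    have := congrArg (Polynomial.eval 0) h
    simp at this
  induction n using Nat.twoStepInduction with
  | zero =>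
    have h : q 0 = 0 := by
      have := hq 0
      simp only [zonal_zero, sub_self] at this
      exact (mul_eq_zero.1 this.symm).resolve_left hX
    simp [h, moment]
  | one =>
    have h : q 1 = 1 := by
      have := hq 1
      simp only [zonal_one] at this
      exact (mul_left_cancel₀ hX (by rw [← this, mul_one]))
    have h0 := cst_mul_integral_jac hl
    simpa [h, moment] using h0
  | more n h1 h2 =>
    -- The quotients `(1 - Z_n) / (1 - X)` inherit the recurrence with the source `2 (n + 1 + lam)
    -- Z_(n+1)`, whose normalized moment is `2 lam`; the sequence `n` solves the resulting
    -- recurrence.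
    have h3 : Polynomial.C ((n : ℝ) + 1 + 2 * lam) * q (n + 2)
        = Polynomial.C (2 * ((n : ℝ) + 1 + lam)) * q (n + 1)
          + Polynomial.C (-((n : ℝ) + 1)) * q n
          + Polynomial.C (2 * (n + 1 + lam)) * zonal lam (n + 1) := by
      apply mul_left_cancel₀ hX
      refine Polynomial.funext fun x => ?_
      have e := zonal_three_term hl n x
      have e0 := congrArg (Polynomial.eval x) (hq n)
      have e1 := congrArg (Polynomial.eval x) (hq (n + 1))
      have e2 := congrArg (Polynomial.eval x) (hq (n + 2))
      simp only [Polynomial.eval_mul, Polynomial.eval_sub, Polynomial.eval_one, Polynomial.eval_X]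
        at e0 e1 e2
      simp only [Polynomial.eval_add, Polynomial.eval_mul, Polynomial.eval_C, Polynomial.eval_X,
        Polynomial.eval_sub, Polynomial.eval_one]
      linear_combination -(n + 1 + 2 * lam) * e2 + 2 * (n + 1 + lam) * e1 - (n + 1) * e0 - e
    have h4 := congrArg (moment lam) h3
    rw [moment_C_mul, moment_add hl, moment_add hl, moment_C_mul, moment_C_mul, moment_C_mul] at h4
    have h5 := moment_zonal hl (n + 1)
    have h6 : (n : ℝ) + 1 + 2 * lam ≠ 0 := by positivity
    push_cast at h2 h5 ⊢
    apply mul_left_cancel₀ h6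
    linear_combination 2 ^ (-lam) * cst lam * h4 + 2 * (n + 1 + lam) * h2 - (n + 1) * h1 + 2 * h5

/-- The jump kernel `2^(-lam) (1 - w)^(-lam - 1)` has eigenvalue `n` on polynomials of degree `n`. -/
lemma lintegral_jump_zonal (n : ℕ) :
    ∫⁻ w, ENNReal.ofReal (2 ^ (-lam) * (1 - w) ^ (-lam - 1))
      * ENNReal.ofReal (1 - (zonal lam n).eval w) ∂(law lam) = n := by
  choose q hq using fun n => exists_one_sub_zonal hl n
  have hqw : ∀ w, 1 - (zonal lam n).eval w = (1 - w) * (q n).eval w := fun w => by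
    simpa using congrArg (Polynomial.eval w) (hq n)
  have h := moment_quotient hl hq n
  have e : ∀ w ∈ Ioo (-1 : ℝ) 1, ENNReal.ofReal (dens lam w) *
      (ENNReal.ofReal (2 ^ (-lam) * (1 - w) ^ (-lam - 1))
        * ENNReal.ofReal (1 - (zonal lam n).eval w))
      = ENNReal.ofReal (2 ^ (-lam) * cst lam * (jac (-1 / 2) (lam - 1 / 2) w * (q n).eval w)) := by
    intro w hw
    have h1 : 0 < 1 - w := by linarith [hw.2]
    rw [← ENNReal.ofReal_mul (by positivity), ← ENNReal.ofReal_mul (dens_pos hl hw).le, hqw]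
    congr 1
    -- The zero of `1 - Z_n` at `1` tames the singularity: what remains is the integrable weight
    -- defining `moment`.
    have h2 : jac (lam - 1 / 2) (lam - 1 / 2) w * ((1 - w) ^ (-lam - 1) * (1 - w))
        = jac (-1 / 2) (lam - 1 / 2) w := by
      rw [← Real.rpow_add_one h1.ne', jac, jac, mul_right_comm, ← Real.rpow_add h1]
      congr 2
      ring
    rw [dens, ← h2]
    ring
  rw [lintegral_law, setLIntegral_congr_fun measurableSet_Ioo e,
    ← ofReal_integral_eq_lintegral_ofReal ((integrableOn_jac_polynomial hl (q n)).const_mul _)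
      (ae_restrict_of_forall_mem measurableSet_Ioo fun w hw => ?_), integral_const_mul]
  · change ENNReal.ofReal (_ * moment lam (q n)) = _
    rw [h, ENNReal.ofReal_natCast]
  · have h1 : 0 < 1 - w := by linarith [hw.2]
    have h2 := zonal_le_one hl (Ioo_subset_Icc_self hw) n
    have h3 : 0 ≤ (q n).eval w := by
      have := hqw w
      by_contra h4
      nlinarith
    have h4 := jac_pos (-1 / 2) (lam - 1 / 2) hw
    have h5 := cst_pos hl
    simp only [Pi.zero_apply]
    positivity

end

/-! ### Two integral representations of the kernel. -/

lemma setOf_eq_image_inv {u : ℝ} (hu0 : 0 ≤ u) (hu1 : u < 1) :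
    {t : ℝ | 1 < t ∧ u * t < 1} = (fun z : ℝ => (1 - (1 - u) * (1 + z) / 2)⁻¹) '' Ioo (-1) 1 := by
  ext t
  simp only [mem_ofPred_eq, mem_image]
  constructor
  · rintro ⟨h1, h2⟩
    have ht : 0 < t := by linarith
    have hv : 0 < 1 - u := by linarith
    refine ⟨2 * (1 - t⁻¹) / (1 - u) - 1, ⟨?_, ?_⟩, ?_⟩
    · have : 0 < 1 - t⁻¹ := sub_pos.2 (inv_lt_one_of_one_lt₀ h1)
      have : 0 < 2 * (1 - t⁻¹) / (1 - u) := by positivity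
      linarith
    · have : u < t⁻¹ := by rw [← one_div]; exact (lt_div_iff₀ ht).2 h2
      have : 2 * (1 - t⁻¹) / (1 - u) < 2 := by rw [div_lt_iff₀ hv]; linarith
      linarith
    · have : 1 - (1 - u) * (1 + (2 * (1 - t⁻¹) / (1 - u) - 1)) / 2 = t⁻¹ := by
        field_simp
        ring
      rw [this, inv_inv]
  · rintro ⟨z, hz, rfl⟩
    have hm : u < 1 - (1 - u) * (1 + z) / 2 := by nlinarith [hz.1, hz.2]
    have hm1 : 1 - (1 - u) * (1 + z) / 2 < 1 := by nlinarith [hz.1, hz.2]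
    have hm0 : 0 < 1 - (1 - u) * (1 + z) / 2 := by linarith
    exact ⟨(one_lt_inv₀ hm0).2 hm1, by rwa [← div_eq_mul_inv, div_lt_one hm0]⟩

/-- The substitution is affine in `1 / t`, which runs over `(u, 1)`; it covers `u = 0`, that is, the
diagonal of the kernel. -/
lemma kernelAux_eq_inv {lam u : ℝ} (hu0 : 0 ≤ u) (hu1 : u < 1) :
    kernelAux lam u = (1 - u) ^ (2 * lam - 1) * 2 ^ (1 - 2 * lam) *
      ∫ z in Ioo (-1) 1, jac (lam - 1) (lam - 1) z * (1 - (1 - u) * (1 + z) / 2) ^ (1 - lam) := by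
  have hm : ∀ z ∈ Ioo (-1 : ℝ) 1, 0 < 1 - (1 - u) * (1 + z) / 2 := fun z hz => by
    nlinarith [hz.1, hz.2]
  have hv : 0 < 1 - u := by linarith
  rw [kernelAux, setOf_eq_image_inv hu0 hu1, integral_image_eq_integral_abs_deriv_smul
    (f' := fun z => ((1 - u) / 2) / (1 - (1 - u) * (1 + z) / 2) ^ 2) measurableSet_Ioo
    (fun z hz => ?_) (fun z hz z' hz' h => ?_), ← integral_const_mul]
  · refine setIntegral_congr_fun measurableSet_Ioo fun z hz => ?_
    have h0 := hm z hz
    have h1 : 0 < 1 - z := by linarith [hz.2]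
    have h2 : 0 < 1 + z := by linarith [hz.1]
    set m := 1 - (1 - u) * (1 + z) / 2 with hmdef
    have e1 : (m⁻¹ - 1) * (1 - u * m⁻¹) = (1 - u) ^ 2 * ((1 - z) * (1 + z)) * (2 ^ 2 * m ^ 2)⁻¹ := by
      have hmi : m⁻¹ * m = 1 := inv_mul_cancel₀ h0.ne'
      have e2 : m⁻¹ - 1 = (1 - u) * (1 + z) / (2 * m) := by
        rw [eq_div_iff (by positivity)]; linear_combination 2 * hmi - 2 * hmdef
      have e3 : 1 - u * m⁻¹ = (1 - u) * (1 - z) / (2 * m) := by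
        rw [eq_div_iff (by positivity)]; linear_combination -2 * u * hmi + 2 * hmdef
      rw [e2, e3]; field_simp
    have hd : 0 < (1 - u) / 2 / m ^ 2 := by positivity
    simp only [smul_eq_mul]
    rw [abs_of_pos hd, e1, Real.mul_rpow (by positivity) (by positivity),
      Real.mul_rpow (by positivity) (by positivity), Real.mul_rpow h1.le h2.le,
      Real.inv_rpow (by positivity), Real.mul_rpow (by positivity) (by positivity), jac,
      ← Real.rpow_natCast_mul hv.le, ← Real.rpow_natCast_mul h0.le,
      ← Real.rpow_natCast_mul (by norm_num), Real.inv_rpow h0.le]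
    push_cast
    have f1 : (1 - u) ^ (2 * lam - 1) = (1 - u) ^ (2 * (lam - 1)) * (1 - u) := by
      rw [← Real.rpow_add_one hv.ne']; congr 1; ring
    have f2 : (2 : ℝ) ^ (1 - 2 * lam) = (2 ^ (2 * (lam - 1)) * 2)⁻¹ := by
      rw [← Real.rpow_add_one (by norm_num), ← Real.rpow_neg (by norm_num)]; congr 1; ring
    have f3 : m ^ (1 - lam) = m ^ (lam + 1) / (m ^ (2 * (lam - 1)) * m ^ 2) := by
      rw [eq_div_iff (by positivity), ← Real.rpow_natCast m 2, ← Real.rpow_add h0,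
        ← Real.rpow_add h0]
      congr 1; push_cast; ring
    rw [f1, f2, f3]
    have g1 : 0 < m ^ (2 * (lam - 1)) := by positivity
    have g2 : 0 < m ^ (lam + 1) := by positivity
    have g3 : (0 : ℝ) < 2 ^ (2 * (lam - 1)) := by positivity
    field_simp
  · have h0 := hm z hz
    have e1 : HasDerivAt (fun z => 1 - (1 - u) * (1 + z) / 2) (-((1 - u) / 2)) z := by
      have := ((((hasDerivAt_id z).const_add 1).const_mul (1 - u)).div_const 2).const_sub 1
      simpa using this
    have := e1.inv h0.ne'
    refine (this.congr_deriv ?_).hasDerivWithinAt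
    ring
  · have := inv_injective h
    have h3 : (1 - u) * (z - z') = 0 := by linarith
    have := (mul_eq_zero.1 h3).resolve_left hv.ne'
    linarith

lemma setOf_eq_image_affine {u : ℝ} (hu0 : 0 < u) (hu1 : u < 1) :
    {t : ℝ | 1 < t ∧ u * t < 1} = (fun z : ℝ => (u + (1 - u) * (1 - z) / 2) / u) '' Ioo (-1) 1 := by
  ext t
  simp only [mem_ofPred_eq, mem_image]
  have hv : 0 < 1 - u := by linarith
  constructor
  · rintro ⟨h1, h2⟩
    refine ⟨1 - 2 * (u * t - u) / (1 - u), ⟨?_, ?_⟩, ?_⟩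
    · have : 2 * (u * t - u) / (1 - u) < 2 := by rw [div_lt_iff₀ hv]; linarith
      linarith
    · have h3 : 0 < u * t - u := by nlinarith
      have : 0 < 2 * (u * t - u) / (1 - u) := by positivity
      linarith
    · field_simp
      ring
  · rintro ⟨z, hz, rfl⟩
    have h3 : 0 < (1 - u) * (1 - z) := mul_pos hv (by linarith [hz.2])
    have h4 : 0 < (1 - u) * (1 + z) := mul_pos hv (by linarith [hz.1])
    exact ⟨by rw [lt_div_iff₀ hu0]; linarith, by rw [mul_div_cancel₀ _ hu0.ne']; linarith⟩

/-- The substitution is affine in `t`; it needs `u > 0` but produces the exponent `-lam - 1` of the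
jump kernel. -/
lemma kernelAux_eq_affine {lam u : ℝ} (hu0 : 0 < u) (hu1 : u < 1) :
    kernelAux lam u = u * ((1 - u) ^ (2 * lam - 1) * 2 ^ (1 - 2 * lam)) *
      ∫ z in Ioo (-1) 1, jac (lam - 1) (lam - 1) z * (u + (1 - u) * (1 - z) / 2) ^ (-lam - 1) := by
  have hv : 0 < 1 - u := by linarith
  have hm : ∀ z ∈ Ioo (-1 : ℝ) 1, 0 < u + (1 - u) * (1 - z) / 2 := fun z hz => by
    have h3 : 0 < (1 - u) * (1 - z) := mul_pos hv (by linarith [hz.2])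
    linarith
  rw [kernelAux, setOf_eq_image_affine hu0 hu1, integral_image_eq_integral_abs_deriv_smul
    (f' := fun z => -((1 - u) / 2 / u)) measurableSet_Ioo
    (fun z hz => ?_) (fun z hz z' hz' h => ?_), ← integral_const_mul]
  · refine setIntegral_congr_fun measurableSet_Ioo fun z hz => ?_
    have h0 := hm z hz
    have h1 : 0 < 1 - z := by linarith [hz.2]
    have h2 : 0 < 1 + z := by linarith [hz.1]
    set m := u + (1 - u) * (1 - z) / 2 with hmdef
    have e1 : (m / u - 1) * (1 - u * (m / u))
        = (1 - u) ^ 2 * ((1 - z) * (1 + z)) * (2 ^ 2 * u)⁻¹ := by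
      rw [mul_div_cancel₀ _ hu0.ne', hmdef]; field_simp; ring
    have hd : 0 < (1 - u) / 2 / u := by positivity
    simp only [smul_eq_mul]
    rw [abs_neg, abs_of_pos hd, e1, Real.mul_rpow (by positivity) (by positivity),
      Real.mul_rpow (by positivity) (by positivity), Real.mul_rpow h1.le h2.le,
      Real.inv_rpow (by positivity), Real.mul_rpow (by positivity) (by positivity), jac,
      ← Real.rpow_natCast_mul hv.le,
      ← Real.rpow_natCast_mul (by norm_num), Real.div_rpow h0.le hu0.le]
    push_cast
    have f1 : (1 - u) ^ (2 * lam - 1) = (1 - u) ^ (2 * (lam - 1)) * (1 - u) := by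
      rw [← Real.rpow_add_one hv.ne']; congr 1; ring
    have f2 : (2 : ℝ) ^ (1 - 2 * lam) = (2 ^ (2 * (lam - 1)) * 2)⁻¹ := by
      rw [← Real.rpow_add_one (by norm_num), ← Real.rpow_neg (by norm_num)]; congr 1; ring
    have f3 : m ^ (-lam - 1) = (m ^ (lam + 1))⁻¹ := by
      rw [← Real.rpow_neg h0.le]; congr 1; ring
    have f4 : u ^ (lam + 1) = u ^ (lam - 1) * u ^ 2 := by
      rw [← Real.rpow_natCast u 2, ← Real.rpow_add hu0]; congr 1; push_cast; ring
    rw [f1, f2, f3, f4]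
    have g1 : 0 < u ^ (lam - 1) := by positivity
    have g2 : 0 < m ^ (lam + 1) := by positivity
    have g3 : (0 : ℝ) < 2 ^ (2 * (lam - 1)) := by positivity
    field_simp
  · have := (((((hasDerivAt_id z).const_sub 1).const_mul (1 - u)).div_const 2).const_add u).div_const u
    refine (this.congr_deriv ?_).hasDerivWithinAt
    ring
  · have h2 := (div_left_inj' hu0.ne').1 h
    have h3 : (1 - u) * (z' - z) = 0 := by linarith
    have := (mul_eq_zero.1 h3).resolve_left hv.ne'
    linarith

section
variable {x y : ℝ}

lemma sin_mul_sin_sq (hx : x ∈ Icc (-1 : ℝ) 1) (hy : y ∈ Icc (-1 : ℝ) 1) :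
    √((1 - x ^ 2) * (1 - y ^ 2)) ^ 2 = (1 - x ^ 2) * (1 - y ^ 2) :=
  Real.sq_sqrt (mul_nonneg (by nlinarith [hx.1, hx.2]) (by nlinarith [hy.1, hy.2]))

lemma sin_mul_sin_pos (hx : x ∈ Ioo (-1 : ℝ) 1) (hy : y ∈ Ioo (-1 : ℝ) 1) :
    0 < √((1 - x ^ 2) * (1 - y ^ 2)) :=
  Real.sqrt_pos.2 (mul_pos (by nlinarith [hx.1, hx.2]) (by nlinarith [hy.1, hy.2]))

lemma one_sub_mul_nonneg (hx : x ∈ Icc (-1 : ℝ) 1) (hy : y ∈ Icc (-1 : ℝ) 1) :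
    0 ≤ 1 - x * y := by
  have := abs_le.2 hx
  have := abs_le.2 hy
  have h : |x * y| ≤ 1 := by rw [abs_mul]; exact mul_le_one₀ ‹_› (abs_nonneg _) ‹_›
  linarith [(abs_le.1 h).2]

lemma sin_mul_sin_le (hx : x ∈ Icc (-1 : ℝ) 1) (hy : y ∈ Icc (-1 : ℝ) 1) :
    √((1 - x ^ 2) * (1 - y ^ 2)) ≤ 1 - x * y :=
  Real.sqrt_le_iff.2 ⟨one_sub_mul_nonneg hx hy, by nlinarith [sq_nonneg (x - y)]⟩

/-- The difference of the two sides is `(1 - x y - s) (1 + z) / 2`. -/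
lemma mul_one_sub_le (hx : x ∈ Icc (-1 : ℝ) 1) (hy : y ∈ Icc (-1 : ℝ) 1) {z : ℝ}
    (hz : z ∈ Icc (-1 : ℝ) 1) :
    (1 - x * y + √((1 - x ^ 2) * (1 - y ^ 2))) * (1 - z) / 2
      ≤ 1 - x * y - √((1 - x ^ 2) * (1 - y ^ 2)) * z := by
  have := sin_mul_sin_le hx hy
  nlinarith [hz.1, hz.2]

/-- Since `(1 - x y)² - s² = (x - y)²`, one has `1 - u = 2 s / a`, and the power of `1 - u` cancels
the singular denominator of `kernelH`. The integral `I` is left free so that both substitutions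
share this computation. -/
lemma kernelH_prefactor {lam : ℝ} (hl : 0 < lam) (hx : x ∈ Ioo (-1 : ℝ) 1)
    (hy : y ∈ Ioo (-1 : ℝ) 1) {I : ℝ} {a : ℝ} (ha : a = 1 - x * y + √((1 - x ^ 2) * (1 - y ^ 2)))
    (hI : kernelAux lam ((x - y) ^ 2 / a ^ 2)
      = (1 - (x - y) ^ 2 / a ^ 2) ^ (2 * lam - 1) * 2 ^ (1 - 2 * lam) * I) :
    kernelH lam x y = 2 ^ (-lam) * angCst lam * (a ^ (1 - lam) * I) := by
  have hs := sin_mul_sin_pos hx hy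
  have hss := sin_mul_sin_sq (Ioo_subset_Icc_self hx) (Ioo_subset_Icc_self hy)
  have hle := sin_mul_sin_le (Ioo_subset_Icc_self hx) (Ioo_subset_Icc_self hy)
  have ha0 : 0 < a := by rw [ha]; linarith
  rw [kernelH, if_neg hl.ne', ← ha, hI, ← hss]
  set s := √((1 - x ^ 2) * (1 - y ^ 2))
  have e1 : 1 - (x - y) ^ 2 / a ^ 2 = 2 * s / a := by
    rw [eq_div_iff ha0.ne', sub_mul, one_mul, sub_eq_iff_eq_add]
    have : a - 2 * s = 1 - x * y - s := by rw [ha]; ring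
    field_simp
    rw [ha]
    nlinarith
  have hG := Real.Gamma_pos_of_pos hl
  have hG2 := Real.Gamma_pos_of_pos (show 0 < lam + lam by linarith)
  rw [e1, Real.div_rpow (by positivity) ha0.le, Real.mul_rpow (by norm_num) hs.le,
    ← Real.rpow_natCast_mul hs.le, angCst, beta, two_mul lam]
  push_cast
  rw [show 2 * (lam - 1 / 2) = lam + lam - 1 by ring]
  have f1 : a ^ (lam + lam - 1) = a ^ lam / a ^ (1 - lam) := by
    rw [← Real.rpow_sub ha0]; congr 1; ring
  have f2 : (2 : ℝ) ^ (3 * lam - 1) = 2 ^ (lam + lam - 1) * 2 ^ lam := by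
    rw [← Real.rpow_add (by norm_num)]; congr 1; ring
  have f3 : (2 : ℝ) ^ (1 - (lam + lam)) = (2 ^ (lam + lam - 1))⁻¹ := by
    rw [← Real.rpow_neg (by norm_num)]; congr 1; ring
  rw [f1, f2, f3, Real.rpow_neg (by norm_num)]
  have g1 : 0 < a ^ lam := by positivity
  have g2 : 0 < a ^ (1 - lam) := by positivity
  have g3 : (0 : ℝ) < 2 ^ (lam + lam - 1) := by positivity
  have g4 : (0 : ℝ) < 2 ^ lam := by positivity
  have g5 : 0 < s ^ (lam + lam - 1) := by positivity
  field_simp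

/-- The kernel as an average of `(1 - x y - s z)^(1 - lam)`. -/
lemma kernelH_eq_integral_ang {lam : ℝ} (hl : 0 ≤ lam) (hx : x ∈ Ioo (-1 : ℝ) 1)
    (hy : y ∈ Ioo (-1 : ℝ) 1) :
    kernelH lam x y
      = 2 ^ (-lam) * ∫ z, (1 - x * y - √((1 - x ^ 2) * (1 - y ^ 2)) * z) ^ (1 - lam) ∂(ang lam) := by
  have hs := sin_mul_sin_pos hx hy
  have hss := sin_mul_sin_sq (Ioo_subset_Icc_self hx) (Ioo_subset_Icc_self hy)
  have hle := sin_mul_sin_le (Ioo_subset_Icc_self hx) (Ioo_subset_Icc_self hy)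
  rcases hl.eq_or_lt with rfl | hl
  · rw [integral_ang_zero, kernelH, if_pos rfl]
    simp
  obtain ⟨a, ha⟩ : ∃ a, a = 1 - x * y + √((1 - x ^ 2) * (1 - y ^ 2)) := ⟨_, rfl⟩
  have ha0 : 0 < a := by rw [ha]; linarith
  have hu1 : (x - y) ^ 2 / a ^ 2 < 1 := by
    rw [div_lt_one (by positivity), ha]; nlinarith
  have hu0 : 0 ≤ (x - y) ^ 2 / a ^ 2 := by positivity
  have hau : a * (1 - (x - y) ^ 2 / a ^ 2) = 2 * √((1 - x ^ 2) * (1 - y ^ 2)) := by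
    field_simp
    rw [ha]; nlinarith
  rw [kernelH_prefactor hl hx hy ha (kernelAux_eq_inv hu0 hu1), integral_ang hl, mul_assoc,
    ← integral_const_mul, ← integral_const_mul]
  congr 1
  refine setIntegral_congr_fun measurableSet_Ioo fun z hz => ?_
  have hm : 0 < 1 - (1 - (x - y) ^ 2 / a ^ 2) * (1 + z) / 2 := by nlinarith [hz.1, hz.2]
  have e : a * (1 - (1 - (x - y) ^ 2 / a ^ 2) * (1 + z) / 2)
      = 1 - x * y - √((1 - x ^ 2) * (1 - y ^ 2)) * z := by
    have : a = 1 - x * y + √((1 - x ^ 2) * (1 - y ^ 2)) := ha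
    linear_combination this - (1 + z) / 2 * hau
  simp only [angDens]
  rw [← e, Real.mul_rpow ha0.le hm.le]
  ring

/-- The kernel as an average of the jump kernel. -/
lemma kernelH_eq_sq_mul_integral_ang {lam : ℝ} (hl : 0 ≤ lam) (hx : x ∈ Ioo (-1 : ℝ) 1)
    (hy : y ∈ Ioo (-1 : ℝ) 1) (hxy : x ≠ y) :
    kernelH lam x y = (x - y) ^ 2 *
      ∫ z, 2 ^ (-lam) * (1 - x * y - √((1 - x ^ 2) * (1 - y ^ 2)) * z) ^ (-lam - 1) ∂(ang lam) := by
  have hs := sin_mul_sin_pos hx hy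
  have hss := sin_mul_sin_sq (Ioo_subset_Icc_self hx) (Ioo_subset_Icc_self hy)
  have hle := sin_mul_sin_le (Ioo_subset_Icc_self hx) (Ioo_subset_Icc_self hy)
  have hd : 0 < (x - y) ^ 2 := by
    have := sub_ne_zero.2 hxy
    positivity
  obtain ⟨a, ha⟩ : ∃ a, a = 1 - x * y + √((1 - x ^ 2) * (1 - y ^ 2)) := ⟨_, rfl⟩
  have ha0 : 0 < a := by rw [ha]; linarith
  rw [integral_const_mul]
  rcases hl.eq_or_lt with rfl | hl
  · have h1 : 1 - x * y + √((1 - x ^ 2) * (1 - y ^ 2)) ≠ 0 := by rw [← ha]; exact ha0.ne'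
    have h2 : 1 - x * y - √((1 - x ^ 2) * (1 - y ^ 2)) ≠ 0 := by
      intro h
      nlinarith
    rw [integral_ang_zero, kernelH, if_pos rfl]
    simp only [neg_zero, zero_sub, Real.rpow_neg_one, Real.rpow_zero, one_mul, mul_one, mul_neg,
      sub_neg_eq_add]
    set s := √((1 - x ^ 2) * (1 - y ^ 2))
    field_simp
    linear_combination (-(2 * (1 - x * y))) * hss
  have hu1 : (x - y) ^ 2 / a ^ 2 < 1 := by
    rw [div_lt_one (by positivity), ha]; nlinarith
  have hu0 : 0 < (x - y) ^ 2 / a ^ 2 := by positivity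
  have hau : a * (1 - (x - y) ^ 2 / a ^ 2) = 2 * √((1 - x ^ 2) * (1 - y ^ 2)) := by
    field_simp
    rw [ha]; nlinarith
  have hI := kernelAux_eq_affine (lam := lam) hu0 hu1
  rw [mul_comm ((x - y) ^ 2 / a ^ 2), mul_assoc] at hI
  rw [kernelH_prefactor hl hx hy ha hI, integral_ang hl, mul_assoc, mul_left_comm ((x - y) ^ 2)]
  congr 1
  rw [← integral_const_mul, ← integral_const_mul, ← integral_const_mul, ← integral_const_mul]
  refine setIntegral_congr_fun measurableSet_Ioo fun z hz => ?_
  have hm : 0 < (x - y) ^ 2 / a ^ 2 + (1 - (x - y) ^ 2 / a ^ 2) * (1 - z) / 2 := by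
    nlinarith [hz.1, hz.2]
  have e : a * ((x - y) ^ 2 / a ^ 2 + (1 - (x - y) ^ 2 / a ^ 2) * (1 - z) / 2)
      = 1 - x * y - √((1 - x ^ 2) * (1 - y ^ 2)) * z := by
    have : a = 1 - x * y + √((1 - x ^ 2) * (1 - y ^ 2)) := ha
    linear_combination this - (1 + z) / 2 * hau
  simp only [angDens]
  rw [← e, Real.mul_rpow ha0.le hm.le]
  have f : a ^ (1 - lam) = a ^ 2 * a ^ (-lam - 1) := by
    rw [← Real.rpow_natCast a 2, ← Real.rpow_add ha0]; congr 1; push_cast; ring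
  rw [f]
  field_simp

end

/-! ### Continuity of the kernel up to the boundary. -/

/-- The continuous extension of the kernel. -/
def kernelExt (lam : ℝ) (p : ℝ × ℝ) : ℝ :=
  2 ^ (-lam) * ∫ z, (1 - p.1 * p.2 - √((1 - p.1 ^ 2) * (1 - p.2 ^ 2)) * z) ^ (1 - lam) ∂(ang lam)

/-- The exponent `1 - lam` is nonnegative and its base lies in `[0, 4]`, so a constant dominates. -/
lemma kernelExt_continuousOn_of_le_one {lam : ℝ} (hl : 0 ≤ lam) (hl1 : lam ≤ 1) :
    ContinuousOn (kernelExt lam) (Icc (-1 : ℝ) 1 ×ˢ Icc (-1 : ℝ) 1) := by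
  have : Fact (0 ≤ lam) := ⟨hl⟩
  refine ContinuousOn.mul continuousOn_const ?_
  refine continuousOn_of_dominated (bound := fun _ => 4 ^ (1 - lam))
    (fun p _ => Measurable.aestronglyMeasurable (by fun_prop)) (fun p hp => ?_)
    (integrable_const _) (Eventually.of_forall fun z => ?_)
  · refine (ae_ang_mem hl).mono fun z hz => ?_
    have h1 := mul_one_sub_le hp.1 hp.2 hz
    have h2 := sin_mul_sin_le hp.1 hp.2
    have h3 := Real.sqrt_nonneg ((1 - p.1 ^ 2) * (1 - p.2 ^ 2))
    have h4 : 1 - p.1 * p.2 ≤ 2 := by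
      have := one_sub_mul_nonneg (x := -p.1) ⟨by linarith [hp.1.2], by linarith [hp.1.1]⟩ hp.2
      linarith
    have h5 : 0 ≤ 1 - p.1 * p.2 - √((1 - p.1 ^ 2) * (1 - p.2 ^ 2)) * z := by
      refine le_trans ?_ h1
      have : 0 ≤ 1 - z := by linarith [hz.2]
      positivity [one_sub_mul_nonneg hp.1 hp.2]
    rw [Real.norm_of_nonneg (Real.rpow_nonneg h5 _)]
    refine Real.rpow_le_rpow h5 ?_ (by linarith)
    nlinarith [hz.1, hz.2]
  · exact ContinuousOn.rpow_const (by fun_prop) fun p _ => Or.inr (by linarith)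

lemma integrable_ang_one_sub_rpow {lam : ℝ} (hl : 0 < lam) :
    Integrable (fun z => (1 - z) ^ (1 - lam)) (ang lam) := by
  rw [ang, if_neg hl.ne', integrable_withDensity_iff_integrable_smul' (by fun_prop)
    (Eventually.of_forall fun _ => ENNReal.ofReal_lt_top)]
  have h := (integrableOn_jac (α := 0) (β := lam - 1) (by norm_num) (by linarith)).const_mul
    (angCst lam)
  refine IntegrableOn.congr_fun h (fun z hz => ?_) measurableSet_Ioo
  have h1 : 0 < 1 - z := by linarith [hz.2]
  simp only [ENNReal.toReal_ofReal (angDens_pos hl hz).le, smul_eq_mul]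
  have h2 : (1 - z) ^ (lam - 1) * (1 - z) ^ (1 - lam) = (1 - z) ^ (0 : ℝ) := by
    rw [← Real.rpow_add h1]
    congr 1
    ring
  rw [angDens, jac, jac, ← h2]
  ring

/-- The exponent is negative, so domination needs a lower bound of the base. By `mul_one_sub_le` it
is `a (1 - z) / 2`, where `a` stays away from zero near any point other than the two corners, and
`(1 - z)^(1 - lam)` is integrable for `ang lam`. -/
lemma kernelExt_continuousOn_of_one_lt {lam : ℝ} (hl : 1 < lam) :
    ContinuousOn (kernelExt lam)
      {p | p ∈ Icc (-1 : ℝ) 1 ×ˢ Icc (-1 : ℝ) 1 ∧ p.1 * p.2 ≠ 1} := by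
  have : Fact (0 ≤ lam) := ⟨by linarith⟩
  refine ContinuousOn.mul continuousOn_const fun p₀ hp₀ => ?_
  obtain ⟨⟨hx₀, hy₀⟩, hne⟩ := hp₀
  set a : ℝ × ℝ → ℝ := fun p => 1 - p.1 * p.2 + √((1 - p.1 ^ 2) * (1 - p.2 ^ 2)) with ha
  have hac : Continuous a := by fun_prop
  have ha₀ : 0 < a p₀ := by
    have h1 := lt_of_le_of_ne (one_sub_mul_nonneg hx₀ hy₀) fun h => hne (by linarith)
    have h2 := Real.sqrt_nonneg ((1 - p₀.1 ^ 2) * (1 - p₀.2 ^ 2))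
    simp only [ha]; linarith
  have hev : ∀ᶠ p in 𝓝[{p | p ∈ Icc (-1 : ℝ) 1 ×ˢ Icc (-1 : ℝ) 1 ∧ p.1 * p.2 ≠ 1}] p₀,
      a p₀ / 2 < a p := by
    refine (hac.continuousAt.eventually (lt_mem_nhds (half_lt_self ha₀))).filter_mono ?_
    exact nhdsWithin_le_nhds
  refine continuousWithinAt_of_dominated
    (bound := fun z => (a p₀ / 4) ^ (1 - lam) * (1 - z) ^ (1 - lam))
    (Eventually.of_forall fun p => Measurable.aestronglyMeasurable (by fun_prop)) ?_
    ((integrable_ang_one_sub_rpow (by linarith)).const_mul _) ?_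
  · filter_upwards [hev, self_mem_nhdsWithin] with p hp hpS
    refine (ae_ang_mem_Ioo (by linarith)).mono fun z hz => ?_
    have h1 := mul_one_sub_le hpS.1.1 hpS.1.2 (Ioo_subset_Icc_self hz)
    have hz1 : 0 < 1 - z := by linarith [hz.2]
    have h2 : a p₀ / 4 * (1 - z) ≤ 1 - p.1 * p.2 - √((1 - p.1 ^ 2) * (1 - p.2 ^ 2)) * z := by
      refine le_trans ?_ h1
      change a p₀ / 4 * (1 - z) ≤ a p * (1 - z) / 2
      nlinarith
    have h3 : 0 < a p₀ / 4 * (1 - z) := by positivity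
    rw [Real.norm_of_nonneg (Real.rpow_nonneg (h3.le.trans h2) _),
      ← Real.mul_rpow (by positivity) hz1.le]
    exact Real.rpow_le_rpow_of_nonpos h3 h2 (by linarith)
  · refine (ae_ang_mem_Ioo (by linarith)).mono fun z hz => ?_
    refine ContinuousWithinAt.rpow_const (by fun_prop) (Or.inl ?_)
    have h1 := mul_one_sub_le hx₀ hy₀ (Ioo_subset_Icc_self hz)
    have hz1 : 0 < 1 - z := by linarith [hz.2]
    have h2 : 0 < a p₀ * (1 - z) / 2 := by positivity
    exact (h2.trans_le h1).ne'

lemma exists_kernel_extension {lam : ℝ} (hl : 0 ≤ lam) :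
    ∃ G : ℝ × ℝ → ℝ,
      ContinuousOn G {p | p ∈ Icc (-1 : ℝ) 1 ×ˢ Icc (-1 : ℝ) 1 ∧ (lam ≤ 1 ∨ p.1 * p.2 ≠ 1)} ∧
      ∀ x ∈ Ioo (-1 : ℝ) 1, ∀ y ∈ Ioo (-1 : ℝ) 1, G (x, y) = kernelH lam x y := by
  refine ⟨kernelExt lam, ?_, fun x hx y hy => (kernelH_eq_integral_ang hl hx hy).symm⟩
  rcases le_or_gt lam 1 with h | h
  · exact (kernelExt_continuousOn_of_le_one hl h).mono fun p hp => hp.1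
  · exact (kernelExt_continuousOn_of_one_lt h).mono fun p hp =>
      ⟨hp.1, hp.2.resolve_left (not_le.2 h)⟩

/-! ### The quotient energy as a jump energy. -/

/-- The average of the jump kernel over the angular law. -/
def jumpKernel (lam : ℝ) (p : ℝ × ℝ) : ℝ :=
  ∫ z, 2 ^ (-lam) * (1 - p.1 * p.2 - √((1 - p.1 ^ 2) * (1 - p.2 ^ 2)) * z) ^ (-lam - 1) ∂(ang lam)

/-- The jump kernel in terms of the inner product `w`. -/
def jump (lam w : ℝ) : ENNReal := ENNReal.ofReal (2 ^ (-lam) * (1 - w) ^ (-lam - 1))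

@[fun_prop]
lemma measurable_jump (lam : ℝ) : Measurable (jump lam) := by unfold jump; fun_prop

section
variable {lam : ℝ} (hl : 0 ≤ lam)
include hl

omit hl in
lemma one_sub_pos_of_ne {x y z : ℝ} (hx : x ∈ Ioo (-1 : ℝ) 1) (hy : y ∈ Ioo (-1 : ℝ) 1)
    (hxy : x ≠ y) (hz : z ∈ Icc (-1 : ℝ) 1) :
    0 < 1 - x * y - √((1 - x ^ 2) * (1 - y ^ 2)) ∧
    1 - x * y - √((1 - x ^ 2) * (1 - y ^ 2)) ≤ 1 - x * y - √((1 - x ^ 2) * (1 - y ^ 2)) * z := by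
  have hs := sin_mul_sin_pos hx hy
  have hss := sin_mul_sin_sq (Ioo_subset_Icc_self hx) (Ioo_subset_Icc_self hy)
  have hle := sin_mul_sin_le (Ioo_subset_Icc_self hx) (Ioo_subset_Icc_self hy)
  have hd : 0 < (x - y) ^ 2 := by
    have := sub_ne_zero.2 hxy
    positivity
  refine ⟨lt_of_le_of_ne (by linarith) fun h => ?_, by nlinarith [hz.2]⟩
  have : √((1 - x ^ 2) * (1 - y ^ 2)) = 1 - x * y := by linarith
  rw [this] at hss
  nlinarith

lemma jumpKernel_nonneg {x y : ℝ} (hx : x ∈ Ioo (-1 : ℝ) 1) (hy : y ∈ Ioo (-1 : ℝ) 1) :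
    0 ≤ jumpKernel lam (x, y) := by
  refine integral_nonneg_of_ae ((ae_ang_mem hl).mono fun z hz => ?_)
  have hle := sin_mul_sin_le (Ioo_subset_Icc_self hx) (Ioo_subset_Icc_self hy)
  have hs := sin_mul_sin_pos hx hy
  have h : 0 ≤ 1 - x * y - √((1 - x ^ 2) * (1 - y ^ 2)) * z := by nlinarith [hz.2]
  simp only [Pi.zero_apply]
  positivity

/-- Off the diagonal the integrand is bounded, so the Bochner integral is not a default zero. -/
lemma ofReal_jumpKernel {x y : ℝ} (hx : x ∈ Ioo (-1 : ℝ) 1) (hy : y ∈ Ioo (-1 : ℝ) 1)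
    (hxy : x ≠ y) :
    ENNReal.ofReal (jumpKernel lam (x, y))
      = ∫⁻ z, jump lam (y * x + √(1 - x ^ 2) * (√(1 - y ^ 2) * z)) ∂(ang lam) := by
  have : Fact (0 ≤ lam) := ⟨hl⟩
  have hx2 : 0 ≤ 1 - x ^ 2 := by nlinarith [hx.1, hx.2]
  rw [jumpKernel, ofReal_integral_eq_lintegral_ofReal]
  · refine lintegral_congr fun z => ?_
    have h : 1 - x * y - √((1 - x ^ 2) * (1 - y ^ 2)) * z
        = 1 - (y * x + √(1 - x ^ 2) * (√(1 - y ^ 2) * z)) := by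
      rw [Real.sqrt_mul hx2]; ring
    simp only [jump, h]
  · obtain ⟨h0, -⟩ := one_sub_pos_of_ne hx hy hxy (z := 1) (by simp)
    refine Integrable.of_bound (C := 2 ^ (-lam)
      * (1 - x * y - √((1 - x ^ 2) * (1 - y ^ 2))) ^ (-lam - 1))
      (Measurable.aestronglyMeasurable (by fun_prop)) ((ae_ang_mem hl).mono fun z hz => ?_)
    obtain ⟨h1, h2⟩ := one_sub_pos_of_ne hx hy hxy hz
    have h3 := h1.trans_le h2
    rw [Real.norm_of_nonneg (by positivity)]
    exact mul_le_mul_of_nonneg_left (Real.rpow_le_rpow_of_nonpos h1 h2 (by linarith))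
      (by positivity)
  · refine (ae_ang_mem hl).mono fun z hz => ?_
    obtain ⟨h1, h2⟩ := one_sub_pos_of_ne hx hy hxy hz
    have h3 := h1.trans_le h2
    simp only [Pi.zero_apply]
    positivity

/-- The factor `(x - y)²` of the kernel cancels the quotient; on the diagonal both sides vanish, as
`0 / 0 = 0`. -/
lemma quotientEnergyDensity_eq (φ : ℝ → ℝ) {x y : ℝ} (hx : x ∈ Ioo (-1 : ℝ) 1)
    (hy : y ∈ Ioo (-1 : ℝ) 1) :
    quotientEnergyDensity lam φ (x, y) = (φ x - φ y) ^ 2 * jumpKernel lam (x, y) := by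
  rcases eq_or_ne x y with rfl | hxy
  · simp [quotientEnergyDensity]
  · have := sub_ne_zero.2 hxy
    rw [quotientEnergyDensity, kernelH_eq_sq_mul_integral_ang hl hx hy hxy, jumpKernel]
    field_simp

omit hl in
lemma ae_prod_law_mem (hl : 0 ≤ lam) : ∀ᵐ p ∂((law lam).prod (law lam)),
    p.1 ∈ Ioo (-1 : ℝ) 1 ∧ p.2 ∈ Ioo (-1 : ℝ) 1 := by
  have : Fact (0 ≤ lam) := ⟨hl⟩
  exact (Measure.quasiMeasurePreserving_fst.ae (ae_law_mem lam)).and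
    (Measure.quasiMeasurePreserving_snd.ae (ae_law_mem lam))

lemma quotientEnergyDensity_ae_nonneg (φ : ℝ → ℝ) :
    0 ≤ᵐ[(law lam).prod (law lam)] quotientEnergyDensity lam φ :=
  (ae_prod_law_mem hl).mono fun p hp => by
    have h := quotientEnergyDensity_eq hl φ hp.1 hp.2
    have h2 := jumpKernel_nonneg hl hp.1 hp.2
    simp only [Pi.zero_apply]
    rw [h]
    positivity

lemma measurable_jumpKernel : Measurable (jumpKernel lam) := by
  have : Fact (0 ≤ lam) := ⟨hl⟩
  refine StronglyMeasurable.measurable (StronglyMeasurable.integral_prod_right'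
    (f := fun q : (ℝ × ℝ) × ℝ => 2 ^ (-lam) * (1 - q.1.1 * q.1.2
      - √((1 - q.1.1 ^ 2) * (1 - q.1.2 ^ 2)) * q.2) ^ (-lam - 1)) ?_)
  exact Measurable.stronglyMeasurable (by fun_prop)

lemma aestronglyMeasurable_quotientEnergyDensity {φ ψ : ℝ → ℝ} (hψ : Continuous ψ)
    (h : EqOn φ ψ (Icc (-1) 1)) :
    AEStronglyMeasurable (quotientEnergyDensity lam φ) ((law lam).prod (law lam)) := by
  have hm : Measurable fun p : ℝ × ℝ => (ψ p.1 - ψ p.2) ^ 2 * jumpKernel lam p :=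
    (((hψ.measurable.comp measurable_fst).sub (hψ.measurable.comp measurable_snd)).pow_const 2).mul
      (measurable_jumpKernel hl)
  refine hm.aestronglyMeasurable.congr ((ae_prod_law_mem hl).mono fun p hp => ?_)
  have h1 := quotientEnergyDensity_eq hl φ hp.1 hp.2
  simp only
  rw [h1, h (Ioo_subset_Icc_self hp.1), h (Ioo_subset_Icc_self hp.2)]

/-- The number operator as a jump energy, for continuous functions. -/
lemma lintegral_quotientEnergyDensity_of_continuous {φ : ℝ → ℝ} (hφ : Continuous φ) :
    ∫⁻ p, ENNReal.ofReal (quotientEnergyDensity lam φ p) ∂((law lam).prod (law lam))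
      = ∑' n : ℕ, ENNReal.ofReal (2 * coeff lam φ n ^ 2) * n := by
  have : Fact (0 ≤ lam) := ⟨hl⟩
  have hφm := hφ.measurable
  have s1 : ∫⁻ p, ENNReal.ofReal (quotientEnergyDensity lam φ p) ∂((law lam).prod (law lam))
      = ∫⁻ x, ∫⁻ y, ∫⁻ z, ENNReal.ofReal ((φ x - φ y) ^ 2)
        * jump lam (y * x + √(1 - x ^ 2) * (√(1 - y ^ 2) * z)) ∂(ang lam) ∂(law lam) ∂(law lam) := by
    rw [lintegral_prod _ (aestronglyMeasurable_quotientEnergyDensity hl hφ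
      (fun _ _ => rfl)).aemeasurable.ennreal_ofReal]
    refine lintegral_congr_ae ((ae_law_mem lam).mono fun x hx => ?_)
    refine lintegral_congr_ae ((ae_law_mem lam).mono fun y hy => ?_)
    simp only
    rw [quotientEnergyDensity_eq hl φ hx hy, ENNReal.ofReal_mul (sq_nonneg _),
      lintegral_const_mul _ (by fun_prop)]
    rcases eq_or_ne x y with rfl | hxy
    · simp
    · rw [ofReal_jumpKernel hl hx hy hxy]
  -- For fixed `x`, reflection exchanges `y` with its inner product `w` with `x`, making `w` the
  -- integration variable.
  have s2 : ∀ x ∈ Ioo (-1 : ℝ) 1, ∫⁻ y, ∫⁻ z, ENNReal.ofReal ((φ x - φ y) ^ 2)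
        * jump lam (y * x + √(1 - x ^ 2) * (√(1 - y ^ 2) * z)) ∂(ang lam) ∂(law lam)
      = ∫⁻ w, ∫⁻ z, ENNReal.ofReal ((φ x - φ (w * x + √(1 - x ^ 2) * (√(1 - w ^ 2) * z))) ^ 2)
        * jump lam w ∂(ang lam) ∂(law lam) := by
    intro x hx
    have hx' := Ioo_subset_Icc_self hx
    have h1 := lintegral_disc hl (F := fun p => ENNReal.ofReal ((φ x - φ p.1) ^ 2)
      * jump lam (refl x p).1) (by fun_prop)
    have h2 := lintegral_disc hl (F := fun p => ENNReal.ofReal ((φ x - φ (refl x p).1) ^ 2)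
      * jump lam p.1) (by fun_prop)
    have h3 : ∫⁻ p, ENNReal.ofReal ((φ x - φ p.1) ^ 2) * jump lam (refl x p).1 ∂(disc lam)
        = ∫⁻ p, ENNReal.ofReal ((φ x - φ (refl x p).1) ^ 2) * jump lam p.1 ∂(disc lam) := by
      conv_lhs => rw [← map_refl_disc hl hx']
      rw [lintegral_map (by fun_prop) (by fun_prop)]
      simp only [refl_refl hx']
    exact h1.symm.trans (h3.trans h2)
  -- For fixed `w`, the integral in `x` and `z` is a translation energy, already diagonalized.
  have s3 : ∀ w ∈ Ioo (-1 : ℝ) 1, ∫⁻ x, ∫⁻ z,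
        ENNReal.ofReal ((φ x - φ (w * x + √(1 - x ^ 2) * (√(1 - w ^ 2) * z))) ^ 2)
        * jump lam w ∂(ang lam) ∂(law lam)
      = ∑' n : ℕ, ENNReal.ofReal (2 * coeff lam φ n ^ 2)
        * (jump lam w * ENNReal.ofReal (1 - (zonal lam n).eval w)) := by
    intro w hw
    have h1 := lintegral_disc hl (F := fun p => ENNReal.ofReal ((φ p.1 - φ (refl w p).1) ^ 2)
      * jump lam w) (by fun_prop)
    rw [lintegral_mul_const _ (by fun_prop),
      lintegral_translateEnergy hl (Ioo_subset_Icc_self hw) hφ, ← ENNReal.tsum_mul_right] at h1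
    have h2 : ∀ n, ENNReal.ofReal (2 * coeff lam φ n ^ 2 * (1 - (zonal lam n).eval w))
        * jump lam w = ENNReal.ofReal (2 * coeff lam φ n ^ 2)
        * (jump lam w * ENNReal.ofReal (1 - (zonal lam n).eval w)) := fun n => by
      rw [ENNReal.ofReal_mul (by positivity)]; ring
    simp_rw [h2] at h1
    rw [h1]
    refine lintegral_congr fun x => lintegral_congr fun z => ?_
    simp only [refl]
    congr 5
    ring
  rw [s1, lintegral_congr_ae ((ae_law_mem lam).mono s2), lintegral_lintegral_swap,
    lintegral_congr_ae ((ae_law_mem lam).mono s3), lintegral_tsum]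
  · refine tsum_congr fun n => ?_
    rw [lintegral_const_mul]
    · congr 1
      exact lintegral_jump_zonal hl n
    · exact (measurable_jump lam).mul
        ((measurable_const.sub (zonal lam n).continuous.measurable).ennreal_ofReal)
  · intro n
    exact (((measurable_jump lam).mul ((measurable_const.sub
      (zonal lam n).continuous.measurable).ennreal_ofReal)).const_mul _).aemeasurable
  · refine Measurable.aemeasurable ?_
    exact Measurable.lintegral_prod_right' (f := fun q : (ℝ × ℝ) × ℝ =>
      ENNReal.ofReal ((φ q.1.1 - φ (q.1.2 * q.1.1 + √(1 - q.1.1 ^ 2) * (√(1 - q.1.2 ^ 2) * q.2))) ^ 2)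
        * jump lam q.1.2) (by fun_prop)

lemma lintegral_quotientEnergyDensity {φ : ℝ → ℝ} (hφ : ContinuousOn φ (Icc (-1) 1)) :
    AEStronglyMeasurable (quotientEnergyDensity lam φ) ((law lam).prod (law lam)) ∧
    ∫⁻ p, ENNReal.ofReal (quotientEnergyDensity lam φ p) ∂((law lam).prod (law lam))
      = ∑' n : ℕ, ENNReal.ofReal (2 * coeff lam φ n ^ 2) * n := by
  -- Clamping the argument extends `φ` continuously to the line; the law does not see the change.
  set ψ : ℝ → ℝ := fun x => φ (max (-1) (min x 1)) with hψ
  have hc : Continuous ψ := hφ.comp_continuous (by fun_prop) fun x =>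
    ⟨le_max_left _ _, max_le (by norm_num) (min_le_right _ _)⟩
  have he : EqOn φ ψ (Icc (-1) 1) := fun x hx => by
    simp only [hψ, min_eq_left hx.2, max_eq_right hx.1]
  refine ⟨aestronglyMeasurable_quotientEnergyDensity hl hc he, ?_⟩
  have h1 : ∀ n, coeff lam φ n = coeff lam ψ n := fun n =>
    integral_congr_ae ((ae_law_mem lam).mono fun x hx => by
      simp only [he (Ioo_subset_Icc_self hx)])
  simp_rw [h1]
  rw [← lintegral_quotientEnergyDensity_of_continuous hl hc]
  refine lintegral_congr_ae ((ae_prod_law_mem hl).mono fun p hp => ?_)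
  simp only [quotientEnergyDensity, he (Ioo_subset_Icc_self hp.1), he (Ioo_subset_Icc_self hp.2)]

/-! ### The variance and the form of the Jacobi operator. -/

lemma variance_law {φ : ℝ → ℝ} (hφ : ContinuousOn φ (Icc (-1) 1)) :
    variance φ (law lam) = ∫ x, φ x ^ 2 ∂(law lam) - (∫ x, φ x ∂(law lam)) ^ 2 := by
  have : Fact (0 ≤ lam) := ⟨hl⟩
  have h : MemLp φ 2 (law lam) :=
    (memLp_two_iff_integrable_sq (integrable_law_of_continuousOn hl hφ).aestronglyMeasurable).2
      (integrable_law_of_continuousOn hl (hφ.pow 2))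
  rw [variance_eq_sub h]
  rfl

omit hl in
lemma continuousOn_der {φ : ℝ → ℝ} (hφ : ContDiffOn ℝ 1 φ (Icc (-1) 1)) :
    ContinuousOn (der φ) (Icc (-1) 1) ∧ ∀ x ∈ Ioo (-1 : ℝ) 1, HasDerivAt φ (der φ x) x := by
  refine ⟨hφ.continuousOn_derivWithin (uniqueDiffOn_Icc (by norm_num)) le_rfl, fun x hx => ?_⟩
  exact ((hφ.differentiableOn one_ne_zero x
    (Ioo_subset_Icc_self hx)).hasDerivWithinAt).hasDerivAt (Icc_mem_nhds hx.1 hx.2)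

lemma integrable_mul_jacobiOp {φ : ℝ → ℝ} (hφ : ContDiffOn ℝ 2 φ (Icc (-1) 1)) :
    Integrable (fun x => φ x * jacobiOp lam φ x) (law lam) ∧
    ∫ x, φ x * jacobiOp lam φ x ∂(law lam) = ∫ x, der φ x ^ 2 * (1 - x ^ 2) ∂(law lam) := by
  have hφ1 : ContDiffOn ℝ 1 φ (Icc (-1) 1) := hφ.of_le (by norm_num)
  have hd1 : ContDiffOn ℝ 1 (der φ) (Icc (-1) 1) :=
    hφ.derivWithin (uniqueDiffOn_Icc (by norm_num)) (by norm_num)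
  obtain ⟨h1, h2⟩ := continuousOn_der hφ1
  obtain ⟨h3, h4⟩ := continuousOn_der hd1
  have h0 := hφ.continuousOn
  unfold jacobiOp
  refine ⟨integrable_law_of_continuousOn hl (by fun_prop), ?_⟩
  rw [← integral_deriv_mul_law hl h0 h1 h1 h3 h2 h4]
  simp_rw [sq (der φ _)]

end
end Gegenbauer

end

/-! ### The theorem, by comparison of eigenvalues. -/

open Gegenbauer in
theorem mainTheorem8 (lam : ℝ) (hlam : 0 ≤ lam) :
    -- the kernel extends continuously to the closed square, up to two corners if `lam > 1`
    (∃ G : ℝ × ℝ → ℝ,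
        ContinuousOn G {p | p ∈ Icc (-1 : ℝ) 1 ×ˢ Icc (-1 : ℝ) 1 ∧ (lam ≤ 1 ∨ p.1 * p.2 ≠ 1)} ∧
        ∀ x ∈ Ioo (-1 : ℝ) 1, ∀ y ∈ Ioo (-1 : ℝ) 1, G (x, y) = Gegenbauer.kernelH lam x y) ∧
    ∀ φ : ℝ → ℝ, ContDiffOn ℝ 1 φ (Icc (-1) 1) →
      -- both integrals converge
      Integrable (fun x => Gegenbauer.der φ x ^ 2 * (1 - x ^ 2)) (Gegenbauer.law lam) ∧
      Integrable (Gegenbauer.quotientEnergyDensity lam φ)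
        ((Gegenbauer.law lam).prod (Gegenbauer.law lam)) ∧
      -- the two Poincare inequalities
      (2 * lam + 1) / 2 * ∫ p, Gegenbauer.quotientEnergyDensity lam φ p
          ∂((Gegenbauer.law lam).prod (Gegenbauer.law lam))
        ≤ ∫ x, Gegenbauer.der φ x ^ 2 * (1 - x ^ 2) ∂(Gegenbauer.law lam) ∧
      2 * variance φ (Gegenbauer.law lam)
        ≤ ∫ p, Gegenbauer.quotientEnergyDensity lam φ p
          ∂((Gegenbauer.law lam).prod (Gegenbauer.law lam)) ∧
      -- the three quantities are the quadratic forms of `L`, `N` and `1 - P`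
      (ContDiffOn ℝ 2 φ (Icc (-1) 1) →
        Integrable (fun x => φ x * Gegenbauer.jacobiOp lam φ x) (Gegenbauer.law lam) ∧
        ∫ x, φ x * Gegenbauer.jacobiOp lam φ x ∂(Gegenbauer.law lam)
          = ∫ x, Gegenbauer.der φ x ^ 2 * (1 - x ^ 2) ∂(Gegenbauer.law lam)) ∧
      HasSum (fun n : ℕ => (n : ℝ) * Gegenbauer.coeff lam φ n ^ 2)
        (1 / 2 * ∫ p, Gegenbauer.quotientEnergyDensity lam φ p
          ∂((Gegenbauer.law lam).prod (Gegenbauer.law lam))) ∧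
      ∫ x, φ x * (φ x - ∫ y, φ y ∂(Gegenbauer.law lam)) ∂(Gegenbauer.law lam)
        = variance φ (Gegenbauer.law lam) := by
  refine ⟨exists_kernel_extension hlam, fun φ hφ => ?_⟩
  have : Fact (0 ≤ lam) := ⟨hlam⟩
  have hc := hφ.continuousOn
  obtain ⟨hd, hd'⟩ := continuousOn_der hφ
  have hnn : ∀ n : ℕ, 0 ≤ (n : ℝ) * coeff lam φ n ^ 2 := fun n => by positivity
  -- Termwise `n (n + 2 lam) ≥ (2 lam + 1) n`, by integrality of `n`. The bound also makes the form
  -- of `N` finite, and with it the double integral.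
  have hbessel : ∀ N, ∑ n ∈ Finset.range N, (2 * lam + 1) * ((n : ℝ) * coeff lam φ n ^ 2)
      ≤ ∫ x, der φ x ^ 2 * (1 - x ^ 2) ∂(law lam) := fun N => by
    refine (Finset.sum_le_sum fun n _ => ?_).trans
      (sum_coeff_sq_le_integral_deriv_sq hlam hc hd hd' N)
    rw [← mul_assoc]
    refine mul_le_mul_of_nonneg_right ?_ (sq_nonneg _)
    rcases Nat.eq_zero_or_pos n with rfl | hn
    · simp
    · have : (1 : ℝ) ≤ n := by exact_mod_cast hn
      nlinarith
  have hsum' : Summable fun n : ℕ => (2 * lam + 1) * ((n : ℝ) * coeff lam φ n ^ 2) :=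
    summable_of_sum_range_le (fun n => mul_nonneg (by linarith) (hnn n)) hbessel
  have hsum : Summable fun n : ℕ => (n : ℝ) * coeff lam φ n ^ 2 :=
    (summable_mul_left_iff (by linarith)).1 hsum'
  obtain ⟨hm, hlint⟩ := lintegral_quotientEnergyDensity hlam hc
  have hE : ∫⁻ p, ENNReal.ofReal (quotientEnergyDensity lam φ p) ∂((law lam).prod (law lam))
      = ENNReal.ofReal (2 * ∑' n : ℕ, (n : ℝ) * coeff lam φ n ^ 2) := by
    rw [hlint, ← tsum_mul_left, ENNReal.ofReal_tsum_of_nonneg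
      (fun n => mul_nonneg (by norm_num) (hnn n)) (hsum.mul_left 2)]
    refine tsum_congr fun n => ?_
    rw [← ENNReal.ofReal_natCast, ← ENNReal.ofReal_mul (by positivity)]
    congr 1
    ring
  have hnnE := quotientEnergyDensity_ae_nonneg hlam φ
  have hint : Integrable (quotientEnergyDensity lam φ) ((law lam).prod (law lam)) :=
    (lintegral_ofReal_ne_top_iff_integrable hm hnnE).1 (by rw [hE]; exact ENNReal.ofReal_ne_top)
  have hval : ∫ p, quotientEnergyDensity lam φ p ∂((law lam).prod (law lam))
      = 2 * ∑' n : ℕ, (n : ℝ) * coeff lam φ n ^ 2 := by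
    rw [integral_eq_lintegral_of_nonneg_ae hnnE hm, hE,
      ENNReal.toReal_ofReal (mul_nonneg (by norm_num) (tsum_nonneg hnn))]
  have hvar := variance_law hlam hc
  have hc0 : coeff lam φ 0 = ∫ x, φ x ∂(law lam) := by
    rw [coeff_eq hlam, orth_zero hlam]; simp
  rw [hval]
  refine ⟨integrable_law_of_continuousOn hlam (by fun_prop), hint, ?_, ?_,
    integrable_mul_jacobiOp hlam, ?_, ?_⟩
  · have h := hsum'.tsum_le_of_sum_range_le hbessel
    rw [tsum_mul_left] at h
    linarith
  · have h := hasSum_coeff_sq hlam hc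
    -- Splitting off `n = 0` removes the squared mean from Parseval's sum and nothing from the form
    -- of `N`.
    have h1 := h.summable.sum_add_tsum_nat_add 1
    have h2 := hsum.sum_add_tsum_nat_add 1
    rw [h.tsum_eq] at h1
    simp only [Finset.range_one, Finset.sum_singleton, Nat.cast_zero, zero_mul, zero_add] at h1 h2
    have h3 : ∑' n : ℕ, coeff lam φ (n + 1) ^ 2
        ≤ ∑' n : ℕ, ((n + 1 : ℕ) : ℝ) * coeff lam φ (n + 1) ^ 2 := by
      refine Summable.tsum_le_tsum (fun n => ?_) ((summable_nat_add_iff 1).2 h.summable)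
        ((summable_nat_add_iff 1).2 hsum)
      refine le_mul_of_one_le_left (sq_nonneg _) ?_
      push_cast
      linarith [(Nat.cast_nonneg n : (0 : ℝ) ≤ n)]
    rw [hvar, ← hc0]
    linarith
  · rw [one_div, inv_mul_cancel_left₀ two_ne_zero]
    exact hsum.hasSum
  · have hi := integrable_law_of_continuousOn hlam hc
    have hi2 : Integrable (fun x => φ x * φ x) (law lam) :=
      integrable_law_of_continuousOn hlam (hc.mul hc)
    simp_rw [mul_sub]
    rw [integral_sub hi2 (hi.mul_const _), integral_mul_const, hvar]
    simp_rw [sq]
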